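/- A composition of $d\ge 0$ is a finite sequence $\alpha=(\alpha_1,\dots,\alpha_k)$ of positive integers with sum $|\alpha|=d$. Its diagram has $\alpha_i$ left-justified cells in the $i$-th row from the bottom; $(i,k)$ is the cell in row $i$ and column $k$. Let $QSym$ be the space of quasisymmetric functions in $x_1,x_2,\dots$ over $\mathbb{Q}$. Let $M_\beta=\sum_{i_1<\dots<i_k}x_{i_1}^{\beta_1}\cdots x_{i_k}^{\beta_k}$ be the monomial quasisymmetric functions and $F_\alpha=\sum_{\beta\text{ refines }\alpha}M_\beta$ the fundamental ones. $QSym$ is a Hopf algebra with coproduct $\Delta F_\alpha=\sum F_\beta\otimes F_\gamma$, summed over all pairs $(\beta,\gamma)$ such that $\alpha$ is the concatenation $\beta\gamma$ or the almost concatenation $(\beta_1,\dots,\beta_{k-1},\beta_k+\gamma_1,\gamma_2,\dots,\gamma_m)$ (the latter for nonempty $\beta,\gamma$), and with counit $\varepsilon(F_\emptyset)=1$ and $\varepsilon(F_\alpha)=0$ for $\alpha\neq\emptyset$. Its antipode $S$ is the two-sided convolution inverse of the identity. The omega operator is the linear map $\omega:QSym\to QSym$ with $\omega(F_\alpha)=(-1)^{|\alpha|}S(F_\alpha)$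 for all compositions $\alpha$. For fillings $T$ of the diagram of $\alpha$ with positive integers, put $T(i,k)=\infty$ for positions outside the diagram. Define $$\mathcal{S}_\alpha=\sum_T x^T,\qquad \mathcal{R}_\alpha=\sum_T x^T,\qquad x^T=\prod_{\text{cells }c}x_{T(c)},$$ where * for the Young quasisymmetric Schur function $\mathcal{S}_\alpha$, $T$ runs over the semi-standard Young composition tableaux of shape $\alpha$: rows weakly increase from left to right, the leftmost column strictly increases from bottom to top, and for all rows $i<j$ and every cell $(i,k+1)$ of the diagram, $T(j,k)\le T(i,k+1)$ implies $T(j,k+1)<T(i,k+1)$; * for the Young row-strict quasisymmetric Schur function $\mathcal{R}_\alpha$, $T$ runs over the semi-standard Young row-strict composition tableaux of shape $\alpha$: rows strictly increase from left to right, the leftmost column weakly increases from bottom to top, and for all rows $i<j$ and every cell $(i,k+1)$ of the diagram, $T(j,k)<T(i,k+1)$ implies $T(j,k+1)\le T(i,k+1)$. Theorem. The omega operator $\omega$ exists and is unique. It is an involution and satisfies $\omega(F_\alpha)=F_{w(\alpha)}$ for every composition $\alpha$, where $w(\alpha)$ is the reversal of the complementary composition of $\alpha$ (the composition of $d=|\alpha|$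 whose set of partial sums in $\{1,\dots,d-1\}$ is the complement of that of $\alpha$). For every composition $\alpha$, $\mathcal{S}_\alpha$ lies in $QSym$, and for every $n\ge 0$ $$\omega(\mathcal{S}_\alpha)(x_1,\dots,x_n)=\mathcal{R}_\alpha(x_n,\dots,x_1),$$ where $f(x_1,\dots,x_n)$ denotes $f$ with $x_i=0$ for all $i>n$, and $\mathcal{R}_\alpha(x_n,\dots,x_1)$ is obtained from $\mathcal{R}_\alpha(x_1,\dots,x_n)$ by replacing each $x_i$ with $x_{n+1-i}$. -/

import Mathlib

namespace YoungQSym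

open Finset

noncomputable section

/-! ### Quasisymmetric functions

Power series in the variables `x₁, x₂, x₃, …` with rational coefficients are elements of
`MvPowerSeries ℕ ℚ`; the index `i : ℕ` stands for the variable `x_{i+1}`. -/

/-- The space `QSym` of quasisymmetric functions: power series of bounded degree such that for
every composition `α = (α₁, …, α_k)` and all `i₁ < ⋯ < i_k`, the coefficient of
`x_{i₁}^{α₁} ⋯ x_{i_k}^{α_k}` equals the coefficient of `x₁^{α₁} ⋯ x_k^{α_k}`. -/
def QSym : Submodule ℚ (MvPowerSeries ℕ ℚ) where
  carrier := {f |
    (∃ D : ℕ, ∀ m : ℕ →₀ ℕ, MvPowerSeries.coeff m f ≠ 0 → m.degree ≤ D) ∧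
    ∀ (d : ℕ) (α : Composition d) (i : Fin α.length → ℕ), StrictMono i →
      MvPowerSeries.coeff (∑ j, Finsupp.single (i j) (α.blocksFun j)) f =
        MvPowerSeries.coeff (∑ j : Fin α.length, Finsupp.single (j : ℕ) (α.blocksFun j)) f}
  zero_mem' := ⟨⟨0, fun m hm => absurd (map_zero _) hm⟩, fun d α i _ => by simp⟩
  add_mem' := by
    rintro f g ⟨⟨D, hD⟩, hf⟩ ⟨⟨E, hE⟩, hg⟩
    refine ⟨⟨max D E, fun m hm => ?_⟩, fun d α i hi => by
      rw [map_add, map_add, hf d α i hi, hg d α i hi]⟩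
    by_cases h : MvPowerSeries.coeff m f = 0
    · exact le_max_of_le_right (hE m fun h0 => hm (by rw [map_add, h, h0, add_zero]))
    · exact le_max_of_le_left (hD m h)
  smul_mem' := by
    rintro c f ⟨⟨D, hD⟩, hf⟩
    refine ⟨⟨D, fun m hm => hD m fun h0 => hm ?_⟩, fun d α i hi => ?_⟩
    · rw [map_smul, h0, smul_zero]
    · rw [map_smul, map_smul, hf d α i hi]

/-- The list of nonzero exponents of a monomial, in increasing order of the variables. -/
def exponents (m : ℕ →₀ ℕ) : List ℕ := (m.support.sort (· ≤ ·)).map m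

theorem exponents_sum_single {k : ℕ} (i : Fin k → ℕ) (hi : StrictMono i) (a : Fin k → ℕ)
    (ha : ∀ j, 0 < a j) :
    exponents (∑ j, Finsupp.single (i j) (a j)) = List.ofFn a := by
  set m : ℕ →₀ ℕ := ∑ j, Finsupp.single (i j) (a j) with hm
  have hval : ∀ j, m (i j) = a j := fun j => by
    rw [hm, Finsupp.finsetSum_apply, Finset.sum_eq_single j]
    · simp
    · intro b _ hb
      exact Finsupp.single_eq_of_ne (fun h => hb (hi.injective h.symm))
    · simp
  have hsupp : m.support = (List.ofFn i).toFinset := by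
    ext x
    rw [Finsupp.mem_support_iff, List.mem_toFinset, List.mem_ofFn]
    constructor
    · intro hx
      by_contra hne
      apply hx
      rw [hm, Finsupp.finsetSum_apply]
      refine Finset.sum_eq_zero fun j _ => Finsupp.single_eq_of_ne fun h => hne ⟨j, h.symm⟩
    · rintro ⟨j, rfl⟩
      rw [hval]
      exact (ha j).ne'
  have hsort : m.support.sort (· ≤ ·) = List.ofFn i := by
    rw [hsupp]
    refine (List.toFinset_sort (· ≤ ·) (List.nodup_ofFn.2 hi.injective)).2 ?_
    exact List.pairwise_ofFn.2 fun _ _ h => (hi h).le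
  rw [exponents, hsort, List.map_ofFn]
  congr 1
  funext j
  exact hval j

theorem sum_exponents (m : ℕ →₀ ℕ) : (exponents m).sum = m.degree := by
  rw [exponents, Finsupp.degree, ← List.sum_toFinset _ (Finset.sort_nodup _ _),
    Finset.sort_toFinset]
  rfl

/-- The monomial quasisymmetric function
`M_α = ∑_{i₁ < ⋯ < i_k} x_{i₁}^{α₁} ⋯ x_{i_k}^{α_k}`: the sum of all monomials whose nonzero
exponents, read in increasing order of the variables, are `α₁, …, α_k`. -/
def M {d : ℕ} (α : Composition d) : QSym :=
  ⟨fun m => if exponents m = α.blocks then 1 else 0, by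
    refine ⟨⟨d, fun m hm => ?_⟩, fun e β i hi => ?_⟩
    · by_cases h : exponents m = α.blocks
      · rw [← sum_exponents, h, α.blocks_sum]
      · exact absurd (if_neg h) hm
    · change (if exponents _ = α.blocks then (1 : ℚ) else 0) =
        if exponents _ = α.blocks then (1 : ℚ) else 0
      rw [exponents_sum_single i hi _ fun j => β.one_le_blocksFun j,
        exponents_sum_single (fun j : Fin β.length => (j : ℕ)) (fun _ _ h => h) _
          fun j => β.one_le_blocksFun j]⟩

/-- The composition `β` refines `α`, that is, `α` arises from `β` by summing collections of
consecutive parts: every partial sum of `α` is a partial sum of `β`. -/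
def Refines {d : ℕ} (β α : Composition d) : Prop := α.boundaries ⊆ β.boundaries

open Classical in
/-- Gessel's fundamental quasisymmetric function, the sum of `M_β` over the refinements `β`
of `α`. -/
def F {d : ℕ} (α : Composition d) : QSym := ∑ β : Composition d with Refines β α, M β

/-! ### The antipode and the omega operator -/

/-- `α` is the concatenation `βγ` or the almost concatenation `β ⊙ γ` of `β` and `γ`, the latter
being formed from nonempty `β` and `γ` by adding the last part of `β` to the first part of `γ`. -/
def IsConcat {p q d : ℕ} (β : Composition p) (γ : Composition q) (α : Composition d) : Prop :=
  α.blocks = β.blocks ++ γ.blocks ∨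
    ∃ (l r : List ℕ) (a b : ℕ), β.blocks = l ++ [a] ∧ γ.blocks = b :: r ∧
      α.blocks = l ++ (a + b) :: r

open Classical in
/-- `S` is the antipode of the Hopf algebra `QSym`: the two-sided inverse of the identity under
convolution, `∑ S(f₁) f₂ = ε(f) 1 = ∑ f₁ S(f₂)`, written out on the fundamental basis, where
`Δ F_α = ∑ F_β ⊗ F_γ` over all pairs with `βγ = α` or `β ⊙ γ = α`, and where
`ε(F_α)` is `1` for the empty composition and `0` otherwise. -/
def IsAntipode (S : QSym →ₗ[ℚ] QSym) : Prop :=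
  ∀ (d : ℕ) (α : Composition d),
    (∑ p ∈ antidiagonal d, ∑ β : Composition p.1, ∑ γ : Composition p.2,
      (if IsConcat β γ α then (S (F β) : MvPowerSeries ℕ ℚ) * (F γ : MvPowerSeries ℕ ℚ) else 0)) =
        (if d = 0 then 1 else 0) ∧
    (∑ p ∈ antidiagonal d, ∑ β : Composition p.1, ∑ γ : Composition p.2,
      (if IsConcat β γ α then (F β : MvPowerSeries ℕ ℚ) * (S (F γ) : MvPowerSeries ℕ ℚ) else 0)) =
        (if d = 0 then 1 else 0)

/-- `ω` is the omega operator on `QSym`: the linear map with `ω(F_α) = (-1)^{|α|} S(F_α)`, where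
`S` is the antipode. -/
def IsOmega (ω : QSym →ₗ[ℚ] QSym) : Prop :=
  ∃ S : QSym →ₗ[ℚ] QSym, IsAntipode S ∧
    ∀ (d : ℕ) (α : Composition d), ω (F α) = (-1 : ℚ) ^ d • S (F α)

/-- The complementary composition: its set of partial sums in `{1, …, d - 1}` is the complement of
that of `α`. -/
def complement {d : ℕ} (α : Composition d) : Composition d :=
  CompositionAsSet.toComposition
    { boundaries := univ.filter fun i => i = 0 ∨ i = Fin.last d ∨ i ∉ α.boundaries
      zero_mem := by simp
      getLast_mem := by simp }

/-- The composition `w(α)` in the antipode formula `S(F_α) = (-1)^{|α|} F_{w(α)}`: the reversal of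
the complementary composition. -/
def w {d : ℕ} (α : Composition d) : Composition d := (complement α).reverse

/-! ### Young composition tableaux

The diagram of `α` has `α₁` cells in the bottom row, `α₂` cells in the row above it, and so on. Rows
are numbered from bottom to top and columns from left to right, both starting with `0`. The entry
`t : ℕ` stands for the positive integer `t + 1`. -/

/-- Fillings of the diagram of `α` with positive integers. -/
abbrev Filling {d : ℕ} (α : Composition d) : Type :=
  (i : Fin α.length) → Fin (α.blocksFun i) → ℕ

/-- The entry of `T` in row `i` and column `k`, which is `∞` if this is not a cell of the
diagram. -/
def entry {d : ℕ} {α : Composition d} (T : Filling α) (i : Fin α.length) (k : ℕ) : WithTop ℕ :=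
  if h : k < α.blocksFun i then ((T i ⟨k, h⟩ : ℕ) : WithTop ℕ) else ⊤

/-- The exponent vector of the weight `x^T`: it maps `t` to the number of cells with entry `t`. -/
def content {d : ℕ} {α : Composition d} (T : Filling α) : ℕ →₀ ℕ :=
  ∑ i, ∑ k, Finsupp.single (T i k) 1

/-- Semi-standard Young row-strict composition tableaux. -/
structure IsSSYRT {d : ℕ} {α : Composition d} (T : Filling α) : Prop where
  /-- Rows strictly increase from left to right. -/
  row : ∀ i, StrictMono (T i)
  /-- The leftmost column weakly increases from bottom to top. -/
  col : ∀ i j : Fin α.length, i < j → entry T i 0 ≤ entry T j 0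
  /-- The triple condition, for a cell `(i, k + 1)` and a higher row `j`. -/
  triple : ∀ (i j : Fin α.length) (k : ℕ), i < j → k + 1 < α.blocksFun i →
    entry T j k < entry T i (k + 1) → entry T j (k + 1) ≤ entry T i (k + 1)

/-- Semi-standard Young composition tableaux. -/
structure IsSSYCT {d : ℕ} {α : Composition d} (T : Filling α) : Prop where
  /-- Rows weakly increase from left to right. -/
  row : ∀ i, Monotone (T i)
  /-- The leftmost column strictly increases from bottom to top. -/
  col : ∀ i j : Fin α.length, i < j → entry T i 0 < entry T j 0
  /-- The triple condition, for a cell `(i, k + 1)` and a higher row `j`. -/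
  triple : ∀ (i j : Fin α.length) (k : ℕ), i < j → k + 1 < α.blocksFun i →
    entry T j k ≤ entry T i (k + 1) → entry T j (k + 1) < entry T i (k + 1)

/-- Only finitely many fillings have a given weight, so the coefficients below are honest
cardinalities of finite sets. -/
theorem finite_filling {d : ℕ} (α : Composition d) (m : ℕ →₀ ℕ) :
    {T : Filling α | content T = m}.Finite := by
  have hfin : {T : Filling α | ∀ i, T i ∈ {r : Fin (α.blocksFun i) → ℕ |
      ∀ k, r k ∈ (m.support : Set ℕ)}}.Finite :=
    Set.Finite.pi' fun i => Set.Finite.pi' fun _ => m.support.finite_toSet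
  refine hfin.subset ?_
  rintro T rfl i k
  rw [Finset.mem_coe, Finsupp.mem_support_iff, content, Finsupp.finsetSum_apply]
  refine (Finset.sum_pos' (fun _ _ => Nat.zero_le _) ⟨i, mem_univ i, ?_⟩).ne'
  rw [Finsupp.finsetSum_apply]
  exact Finset.sum_pos' (fun _ _ => Nat.zero_le _) ⟨k, mem_univ k, by simp⟩

/-- The Young row-strict quasisymmetric Schur function `R_α = ∑_T x^T`, summed over all
semi-standard Young row-strict composition tableaux `T` of shape `α`. -/
def youngR {d : ℕ} (α : Composition d) : MvPowerSeries ℕ ℚ :=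
  fun m => (Set.ncard {T : Filling α | IsSSYRT T ∧ content T = m} : ℚ)

/-- The Young quasisymmetric Schur function `S_α = ∑_T x^T`, summed over all
semi-standard Young composition tableaux `T` of shape `α`. -/
def youngS {d : ℕ} (α : Composition d) : MvPowerSeries ℕ ℚ :=
  fun m => (Set.ncard {T : Filling α | IsSSYCT T ∧ content T = m} : ℚ)

/-! ### Finitely many variables -/

/-- `f(x₁, …, x_n)`: keep the first `n` variables and set all others to `0`. -/
def inVars (n : ℕ) (f : MvPowerSeries ℕ ℚ) : MvPowerSeries (Fin n) ℚ :=
  MvPowerSeries.killCompl Fin.valEmbedding f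

/-- `f(x_n, …, x₁)`: the polynomial `f(x₁, …, x_n)` with `x_i` replaced by `x_{n+1-i}`. -/
def inVarsRev (n : ℕ) (f : MvPowerSeries ℕ ℚ) : MvPowerSeries (Fin n) ℚ :=
  MvPowerSeries.renameEquiv ℚ Fin.revPerm (inVars n f)

end

end YoungQSym

/-! All series are treated as generating functions of words or fillings. The basic fact is
`F_eq_chainGen`: `F α` enumerates the weakly increasing words of length `d` that rise strictly at
the partial sums of `α`, which is a condition on adjacent letters only.

Antipode: read backwards, the words of `F (w α)` are those that violate the condition of `α` at
every step (`F_w_eq_chainGen`). For each `p`, exactly one pair `(β, γ)` occurs in the coproduct, and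
`F (w β) * F γ` enumerates the words that violate the condition of `α` before position `p`, satisfy
it after `p`, and are free across the cut. A word occurring at all occurs for exactly two adjacent
cuts, so the alternating sum over `p` vanishes for `d > 0` (`sum_chain_cut`). Hence `F α ↦ (-1)^d F
(w α)` is an antipode. Recursion on degree shows that it is the only one, the signs cancel in `ω`,
and `w_w` makes `ω` an involution.

Tableaux: ties between equal entries are broken by a total order on the cells, so every filling has
a unique standardization, and the fillings with standardization `σ` are enumerated by the
fundamental function of the descent set of `σ` (`gen_eq_sum_F`). For the order `cellKey`, being a
Young composition tableau depends only on the standardization; for the opposite order the same holds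
for row-strict tableaux, with the same class `IsStandard`. Reversing the order complements descent
sets, so `youngS` and `youngR` are sums over the same `σ` of `F β` and of `F (complement β)`. Since
`w` is complement followed by reversal, what remains is that in `n` variables reversing a
composition amounts to reversing the variables (`inVars_F_reverse`). -/

namespace YoungQSym

open Finset

noncomputable section

/-! ### Generating functions of words -/

/-- The exponent vector of the word `u`. -/
def wt {ι : Type*} [Fintype ι] (u : ι → ℕ) : ℕ →₀ ℕ := ∑ i, Finsupp.single (u i) 1

theorem finite_wt (ι : Type*) [Fintype ι] (m : ℕ →₀ ℕ) : {u : ι → ℕ | wt u = m}.Finite := by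
  have hfin : {u : ι → ℕ | ∀ i, u i ∈ (m.support : Set ℕ)}.Finite :=
    Set.Finite.pi' fun i => m.support.finite_toSet
  refine hfin.subset ?_
  rintro u rfl i
  rw [Finset.mem_coe, Finsupp.mem_support_iff, wt, Finsupp.finsetSum_apply]
  exact (Finset.sum_pos' (fun _ _ => Nat.zero_le _) ⟨i, mem_univ i, by simp⟩).ne'

/-- The words with index set `ι` and exponent vector `m`. -/
def words (ι : Type*) [Fintype ι] (m : ℕ →₀ ℕ) : Finset (ι → ℕ) := (finite_wt ι m).toFinset

@[simp] theorem mem_words {ι : Type*} [Fintype ι] {m : ℕ →₀ ℕ} {u : ι → ℕ} :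
    u ∈ words ι m ↔ wt u = m := by simp [words]

/-- The generating function `∑_u φ(u) x^u`. -/
def gen {ι : Type*} [Fintype ι] : ((ι → ℕ) → ℚ) →ₗ[ℚ] MvPowerSeries ℕ ℚ where
  toFun φ := fun m => ∑ u ∈ words ι m, φ u
  map_add' φ ψ := by funext m; exact Finset.sum_add_distrib
  map_smul' c φ := by funext m; exact (Finset.mul_sum _ _ _).symm

theorem coeff_gen {ι : Type*} [Fintype ι] (φ : (ι → ℕ) → ℚ) (m : ℕ →₀ ℕ) :
    MvPowerSeries.coeff m (gen φ) = ∑ u ∈ words ι m, φ u := rfl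

theorem wt_comp_equiv {ι κ : Type*} [Fintype ι] [Fintype κ] (e : ι ≃ κ) (u : κ → ℕ) :
    wt (u ∘ e) = wt u := Equiv.sum_comp e fun k => Finsupp.single (u k) 1

theorem gen_reindex {ι κ : Type*} [Fintype ι] [Fintype κ] (e : ι ≃ κ) (φ : (κ → ℕ) → ℚ) :
    gen (fun u : ι → ℕ => φ (u ∘ e.symm)) = gen φ := by
  ext m
  rw [coeff_gen, coeff_gen]
  refine Finset.sum_nbij' (fun u => u ∘ e.symm) (fun u => u ∘ e) ?_ ?_ ?_ ?_ ?_
  · intro u hu; rw [mem_words] at hu ⊢; rw [wt_comp_equiv, hu]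
  · intro u hu; rw [mem_words] at hu ⊢; rw [wt_comp_equiv, hu]
  · intro u _; funext x; simp
  · intro u _; funext x; simp
  · intro u _; rfl

theorem wt_sum {ι κ : Type*} [Fintype ι] [Fintype κ] (u : ι ⊕ κ → ℕ) :
    wt u = wt (u ∘ Sum.inl) + wt (u ∘ Sum.inr) := Fintype.sum_sum_type _

/-- A pair of words is one word on the disjoint union of the index sets; the splitting of the
exponent in the Cauchy product is recovered from the weights of the two halves. -/
theorem gen_mul {ι κ : Type*} [Fintype ι] [Fintype κ] (φ : (ι → ℕ) → ℚ) (ψ : (κ → ℕ) → ℚ) :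
    gen φ * gen ψ = gen fun u : ι ⊕ κ → ℕ => φ (u ∘ Sum.inl) * ψ (u ∘ Sum.inr) := by
  classical
  ext m
  rw [MvPowerSeries.coeff_mul, coeff_gen]
  simp_rw [coeff_gen, Finset.sum_mul_sum, ← Finset.sum_product']
  rw [Finset.sum_sigma']
  refine Finset.sum_bij' (fun x _ => Sum.elim x.2.1 x.2.2)
    (fun u _ => ⟨(wt (u ∘ Sum.inl), wt (u ∘ Sum.inr)), (u ∘ Sum.inl, u ∘ Sum.inr)⟩)
    ?_ ?_ ?_ ?_ ?_
  · rintro ⟨⟨a, b⟩, u, v⟩ h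
    simp only [mem_sigma, HasAntidiagonal.mem_antidiagonal, mem_product, mem_words] at h ⊢
    rw [wt_sum, Sum.elim_comp_inl, Sum.elim_comp_inr, h.2.1, h.2.2, h.1]
  · intro u h
    simp only [mem_sigma, HasAntidiagonal.mem_antidiagonal, mem_product, mem_words] at h ⊢
    exact ⟨by rw [← wt_sum, h], by simp⟩
  · rintro ⟨⟨a, b⟩, u, v⟩ h
    simp only [mem_sigma, HasAntidiagonal.mem_antidiagonal, mem_product, mem_words] at h
    obtain ⟨-, rfl, rfl⟩ := h
    simp
  · intro u _
    exact Sum.elim_comp_inl_inr u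
  · rintro ⟨⟨a, b⟩, u, v⟩ _
    simp

/-! ### Words defined by conditions on adjacent letters -/

/-- Every two consecutive letters of the word `u`, in positions `i` and `i + 1`, satisfy `R i`. -/
def Chain {d : ℕ} (R : ℕ → ℕ → ℕ → Prop) (u : Fin d → ℕ) : Prop :=
  ∀ (i : ℕ) (h : i + 1 < d), R i (u ⟨i, by omega⟩) (u ⟨i + 1, h⟩)

open Classical in
/-- The generating function of the words of length `d` that form a chain for `R`. -/
def chainGen (d : ℕ) (R : ℕ → ℕ → ℕ → Prop) : MvPowerSeries ℕ ℚ :=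
  gen fun u : Fin d → ℕ => if Chain R u then 1 else 0

theorem Chain.congr {d : ℕ} {R R' : ℕ → ℕ → ℕ → Prop}
    (h : ∀ i a b, i + 1 < d → (R i a b ↔ R' i a b)) (u : Fin d → ℕ) : Chain R u ↔ Chain R' u :=
  forall₂_congr fun i hi => h i _ _ hi

theorem chainGen_congr {d : ℕ} {R R' : ℕ → ℕ → ℕ → Prop}
    (h : ∀ i a b, i + 1 < d → (R i a b ↔ R' i a b)) : chainGen d R = chainGen d R' := by
  classical
  unfold chainGen
  congr 1
  funext u
  exact if_congr (Chain.congr h u) rfl rfl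

/-- The relation `R` before position `p`, the relation `R'` after it, and none across it. -/
def cut (p : ℕ) (R R' : ℕ → ℕ → ℕ → Prop) : ℕ → ℕ → ℕ → Prop :=
  fun i a b => (i + 1 < p → R i a b) ∧ (p ≤ i → R' (i - p) a b)

/-- The step `i = p - 1`, which joins the two halves, satisfies neither `i + 1 < p` nor `p ≤ i`, so
it is unconstrained. -/
theorem chain_cut_iff {p q : ℕ} (R R' : ℕ → ℕ → ℕ → Prop) (u : Fin (p + q) → ℕ) :
    Chain (cut p R R') u ↔ Chain R (u ∘ Fin.castAdd q) ∧ Chain R' (u ∘ Fin.natAdd p) := by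
  constructor
  · intro h
    refine ⟨fun i hi => (h i (by omega)).1 hi, fun i hi => ?_⟩
    have := (h (p + i) (by omega)).2 (by omega)
    rw [Nat.add_sub_cancel_left] at this
    exact this
  · rintro ⟨h, h'⟩ i hi
    refine ⟨fun hp => h i hp, fun hp => ?_⟩
    obtain ⟨j, rfl⟩ := Nat.exists_eq_add_of_le hp
    rw [Nat.add_sub_cancel_left]
    exact h' j (by omega)

theorem chainGen_mul (p q : ℕ) (R R' : ℕ → ℕ → ℕ → Prop) :
    chainGen p R * chainGen q R' = chainGen (p + q) (cut p R R') := by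
  classical
  unfold chainGen
  rw [gen_mul, ← gen_reindex finSumFinEquiv]
  congr 1
  funext u
  rw [chain_cut_iff]
  have h1 : (u ∘ finSumFinEquiv.symm) ∘ Fin.castAdd q = u ∘ Sum.inl := by
    funext x; simp
  have h2 : (u ∘ finSumFinEquiv.symm) ∘ Fin.natAdd p = u ∘ Sum.inr := by
    funext x; simp
  rw [h1, h2]
  by_cases h : Chain R (u ∘ Sum.inl) <;> by_cases h' : Chain R' (u ∘ Sum.inr) <;> simp [h, h']

theorem chain_rev_iff {d : ℕ} (R : ℕ → ℕ → ℕ → Prop) (u : Fin d → ℕ) :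
    Chain R (u ∘ Fin.rev) ↔ Chain (fun i a b => R (d - 2 - i) b a) u := by
  have hx : ∀ i (hi : i + 1 < d), (Fin.rev ⟨i, by omega⟩ : Fin d) = ⟨d - 2 - i + 1, by omega⟩ :=
    fun i hi => Fin.ext (by simp only [Fin.val_rev]; omega)
  have hy : ∀ i (hi : i + 1 < d), (Fin.rev ⟨i + 1, hi⟩ : Fin d) = ⟨d - 2 - i, by omega⟩ :=
    fun i hi => Fin.ext (by simp only [Fin.val_rev]; omega)
  have hz : ∀ i, i + 1 < d → d - 2 - (d - 2 - i) = i := fun i hi => by omega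
  constructor
  · intro h i hi
    have := h (d - 2 - i) (by omega)
    simp only [Function.comp_apply] at this
    rw [hx _ (by omega), hy _ (by omega)] at this
    simpa only [hz i hi] using this
  · intro h i hi
    have := h (d - 2 - i) (by omega)
    simp only [Function.comp_apply]
    rw [hx _ hi, hy _ hi]
    simpa only [hz i hi] using this

theorem chainGen_rev (d : ℕ) (R : ℕ → ℕ → ℕ → Prop) :
    chainGen d R = chainGen d fun i a b => R (d - 2 - i) b a := by
  classical
  unfold chainGen
  rw [← gen_reindex Fin.revPerm]
  congr 1
  funext u
  rw [← chain_rev_iff]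
  rfl

theorem chainGen_zero (R : ℕ → ℕ → ℕ → Prop) : chainGen 0 R = 1 := by
  classical
  ext m
  rw [chainGen, coeff_gen, MvPowerSeries.coeff_one]
  have hc : ∀ u : Fin 0 → ℕ, Chain R u := fun u i hi => absurd hi (by omega)
  simp_rw [if_pos (hc _)]
  split_ifs with h
  · rw [Finset.sum_eq_single_of_mem ![] _ fun b _ hb => absurd (Subsingleton.elim _ _) hb]
    rw [mem_words, h, wt]; rfl
  · rw [Finset.sum_eq_zero]
    intro u hu
    rw [mem_words] at hu
    exact absurd hu.symm (by simpa [wt] using h)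

/-- A word that is a chain for `A` up to some position and for the negation of `A` afterwards has
two such positions with opposite signs, so that the alternating sum of these words vanishes. -/
theorem sum_chain_cut {d : ℕ} (hd : 0 < d) (A B : ℕ → ℕ → ℕ → Prop)
    (hAB : ∀ i a b, B i a b ↔ ¬ A i a b) (u : Fin d → ℕ) [∀ p, Decidable (Chain
      (cut p A fun i => B (i + p)) u)] :
    ∑ p ∈ range (d + 1),
      (-1 : ℚ) ^ p * (if Chain (cut p A fun i => B (i + p)) u then 1 else 0) = 0 := by
  classical
  let T : ℕ → Prop := fun i => ∃ h : i + 1 < d, A i (u ⟨i, by omega⟩) (u ⟨i + 1, h⟩)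
  have hch : ∀ p, Chain (cut p A fun i => B (i + p)) u ↔
      ∀ i, i + 1 < d → (i + 1 < p → T i) ∧ (p ≤ i → ¬ T i) := by
    intro p
    refine forall₂_congr fun i hi => and_congr ?_ ?_
    · exact forall_congr' fun _ => ⟨fun h => ⟨hi, h⟩, fun ⟨_, h⟩ => h⟩
    · refine forall_congr' fun hp => ?_
      simp only [Nat.sub_add_cancel hp, hAB]
      exact not_congr ⟨fun h => ⟨hi, h⟩, fun ⟨_, h⟩ => h⟩
  simp_rw [hch]
  -- `a` is where the steps switch from `T` to `¬ T`. A cut at `p` ignores step `p - 1`, so exactly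
  -- the cuts `a` and `a + 1` are admissible; `a < d` keeps both in range.
  by_cases hex : ∃ a < d, ∀ i, i + 1 < d → (i < a → T i) ∧ (a ≤ i → ¬ T i)
  · obtain ⟨a, ha, h⟩ := hex
    rw [← Finset.sum_subset (s₁ := {a, a + 1}), Finset.sum_pair (by omega), if_pos, if_pos]
    · ring
    · exact fun i hi => ⟨fun h1 => (h i hi).1 (by omega), fun h1 => (h i hi).2 (by omega)⟩
    · exact fun i hi => ⟨fun h1 => (h i hi).1 (by omega), fun h1 => (h i hi).2 (by omega)⟩
    · intro x hx; simp only [mem_insert, mem_singleton] at hx; rw [mem_range]; omega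
    · intro p hp hpa
      rw [mem_range] at hp
      simp only [mem_insert, mem_singleton, not_or] at hpa
      rw [if_neg, mul_zero]
      intro h2
      rcases lt_or_gt_of_ne hpa.1 with hlt | hgt
      · exact (h2 p (by omega)).2 le_rfl ((h p (by omega)).1 hlt)
      · exact (h a (by omega)).2 le_rfl ((h2 a (by omega)).1 (by omega))
  · refine Finset.sum_eq_zero fun p hp => ?_
    rw [mem_range] at hp
    rw [if_neg, mul_zero]
    intro h
    apply hex
    by_cases hp0 : p = 0
    · subst hp0
      exact ⟨0, hd, fun i hi => ⟨fun h1 => by omega, (h i hi).2⟩⟩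
    -- The ignored step `p - 1` decides whether the switch is at `p` or at `p - 1`. The bound
    -- contained in `T` gives `p < d` in the first case.
    · by_cases hT : T (p - 1)
      · have hlt : p < d := by obtain ⟨h1, -⟩ := hT; omega
        refine ⟨p, hlt, fun i hi => ⟨fun h1 => ?_, (h i hi).2⟩⟩
        by_cases h2 : i + 1 < p
        · exact (h i hi).1 h2
        · rwa [show i = p - 1 by omega]
      · refine ⟨p - 1, by omega, fun i hi => ⟨fun h1 => (h i hi).1 (by omega), fun h1 => ?_⟩⟩
        by_cases h2 : p ≤ i
        · exact (h i hi).2 h2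
        · rwa [show i = p - 1 by omega]

theorem sum_chainGen_cut {d : ℕ} (hd : 0 < d) (A B : ℕ → ℕ → ℕ → Prop)
    (hAB : ∀ i a b, B i a b ↔ ¬ A i a b) :
    ∑ p ∈ range (d + 1), (-1 : ℚ) ^ p • chainGen d (cut p A fun i => B (i + p)) = 0 := by
  classical
  simp_rw [chainGen, ← map_smul, ← map_sum]
  rw [← map_zero (gen (ι := Fin d))]
  congr 1
  funext u
  simpa [Finset.sum_apply] using sum_chain_cut hd A B hAB u

/-! ### Partial sums of compositions -/

/-- `s` is the sum of an initial segment of `l`. -/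
def IsPartialSum (l : List ℕ) (s : ℕ) : Prop := ∃ k, (l.take k).sum = s

theorem isPartialSum_nil {s : ℕ} : IsPartialSum [] s ↔ s = 0 := by
  simp [IsPartialSum, eq_comm]

theorem isPartialSum_cons {a : ℕ} {l : List ℕ} {s : ℕ} :
    IsPartialSum (a :: l) s ↔ s = 0 ∨ ∃ t, s = a + t ∧ IsPartialSum l t := by
  constructor
  · rintro ⟨_ | k, rfl⟩
    · exact Or.inl rfl
    · exact Or.inr ⟨(l.take k).sum, by simp, k, rfl⟩
  · rintro (rfl | ⟨t, rfl, k, rfl⟩)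
    · exact ⟨0, rfl⟩
    · exact ⟨k + 1, by simp⟩

theorem isPartialSum_zero (l : List ℕ) : IsPartialSum l 0 := ⟨0, rfl⟩

theorem IsPartialSum.le_sum {l : List ℕ} {s : ℕ} (h : IsPartialSum l s) : s ≤ l.sum := by
  obtain ⟨k, rfl⟩ := h
  exact (List.take_sublist k l).sum_le_sum (by simp)

theorem isPartialSum_append {l l' : List ℕ} {s : ℕ} :
    IsPartialSum (l ++ l') s ↔ IsPartialSum l s ∨ ∃ t, s = l.sum + t ∧ IsPartialSum l' t := by
  induction l generalizing s with
  | nil =>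
    simp only [List.nil_append, isPartialSum_nil, List.sum_nil, zero_add, exists_eq_left']
    refine ⟨Or.inr, ?_⟩
    rintro (rfl | h)
    · exact isPartialSum_zero _
    · exact h
  | cons a l ih =>
    simp only [List.cons_append, isPartialSum_cons, ih, List.sum_cons]
    constructor
    · rintro (rfl | ⟨t, rfl, h | ⟨t', rfl, h⟩⟩)
      · exact Or.inl (Or.inl rfl)
      · exact Or.inl (Or.inr ⟨t, rfl, h⟩)
      · exact Or.inr ⟨t', by ring, h⟩
    · rintro ((rfl | ⟨t, rfl, h⟩) | ⟨t', rfl, h⟩)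
      · exact Or.inl rfl
      · exact Or.inr ⟨t, rfl, Or.inl h⟩
      · exact Or.inr ⟨l.sum + t', by ring, Or.inr ⟨t', rfl, h⟩⟩

theorem isPartialSum_reverse {l : List ℕ} {s t : ℕ} (h : s + t = l.sum) :
    IsPartialSum l.reverse s ↔ IsPartialSum l t := by
  have key : ∀ (l : List ℕ) (s t : ℕ), s + t = l.sum → IsPartialSum l t →
      IsPartialSum l.reverse s := by
    rintro l s t h ⟨k, rfl⟩
    rw [← List.take_append_drop k l, List.reverse_append, isPartialSum_append]
    refine Or.inl ⟨(l.drop k).reverse.length, ?_⟩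
    rw [List.take_length, List.sum_reverse]
    have := List.sum_take_add_sum_drop l k
    omega
  refine ⟨fun h' => ?_, key l s t h⟩
  have := key l.reverse t s (by rw [List.sum_reverse, ← h, add_comm]) h'
  rwa [List.reverse_reverse] at this

theorem mem_boundaries_iff {d : ℕ} (α : Composition d) (x : Fin (d + 1)) :
    x ∈ α.boundaries ↔ IsPartialSum α.blocks x := by
  rw [Composition.boundaries, mem_map]
  constructor
  · rintro ⟨i, -, rfl⟩
    exact ⟨i, rfl⟩
  · rintro ⟨k, hk⟩
    rcases lt_or_ge k (α.length + 1) with h | h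
    · exact ⟨⟨k, h⟩, mem_univ _, Fin.ext hk⟩
    · refine ⟨Fin.last _, mem_univ _, Fin.ext ?_⟩
      rw [← hk]
      exact (α.sizeUpTo_length).trans (α.sizeUpTo_ofLength_le k (by omega)).symm

theorem Composition.boundaries_injective {d : ℕ} {α β : Composition d}
    (h : α.boundaries = β.boundaries) : α = β := by
  have : α.toCompositionAsSet = β.toCompositionAsSet := CompositionAsSet.ext h
  exact (compositionEquiv d).injective this

theorem isPartialSum_total {d : ℕ} (α : Composition d) : IsPartialSum α.blocks d :=
  ⟨α.blocks.length, by rw [List.take_length, α.blocks_sum]⟩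

/-- Since `0` and `d` are always partial sums, only interior ones matter. They are written `i + 1`
because that is the boundary crossed by step `i` of a chain. -/
theorem composition_ext_of_isPartialSum {d : ℕ} {α β : Composition d}
    (h : ∀ i, i + 1 < d → (IsPartialSum α.blocks (i + 1) ↔ IsPartialSum β.blocks (i + 1))) :
    α = β := by
  apply Composition.boundaries_injective
  ext x
  rw [mem_boundaries_iff, mem_boundaries_iff]
  obtain ⟨_ | x, hx⟩ := x
  · exact iff_of_true (isPartialSum_zero _) (isPartialSum_zero _)
  · rcases Nat.lt_or_ge (x + 1) d with h' | h'
    · exact h x h'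
    · obtain rfl : d = x + 1 := by omega
      exact iff_of_true (isPartialSum_total _) (isPartialSum_total _)

/-- The composition of `d` whose partial sums in `{1, …, d - 1}` are described by `P`. -/
def ofPred (d : ℕ) (P : ℕ → Prop) [DecidablePred P] : Composition d :=
  CompositionAsSet.toComposition
    { boundaries := univ.filter fun i => i = 0 ∨ i = Fin.last d ∨ P i
      zero_mem := by simp
      getLast_mem := by simp }

theorem isPartialSum_ofPred {d : ℕ} (P : ℕ → Prop) [DecidablePred P] {i : ℕ} (hi : i + 1 < d) :
    IsPartialSum (ofPred d P).blocks (i + 1) ↔ P (i + 1) := by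
  have := mem_boundaries_iff (ofPred d P) ⟨i + 1, by omega⟩
  rw [← this, ofPred, CompositionAsSet.toComposition_boundaries, mem_filter]
  simp only [mem_univ, true_and, Fin.ext_iff, Fin.val_zero, Fin.val_last]
  constructor
  · rintro (h | h | h)
    · omega
    · omega
    · exact h
  · exact fun h => Or.inr (Or.inr h)

theorem isPartialSum_complement {d : ℕ} (α : Composition d) {i : ℕ} (hi : i + 1 < d) :
    IsPartialSum (complement α).blocks (i + 1) ↔ ¬ IsPartialSum α.blocks (i + 1) := by
  have h1 := mem_boundaries_iff (complement α) ⟨i + 1, by omega⟩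
  have h2 := mem_boundaries_iff α ⟨i + 1, by omega⟩
  rw [← h1, ← h2, complement, CompositionAsSet.toComposition_boundaries, mem_filter]
  simp only [mem_univ, true_and, Fin.ext_iff, Fin.val_zero, Fin.val_last]
  constructor
  · rintro (h | h | h)
    · omega
    · omega
    · exact h
  · exact fun h => Or.inr (Or.inr h)

theorem isPartialSum_reverse_blocks {d : ℕ} (α : Composition d) {i : ℕ} (hi : i + 1 < d) :
    IsPartialSum α.reverse.blocks (i + 1) ↔ IsPartialSum α.blocks (d - 2 - i + 1) :=
  isPartialSum_reverse (by rw [α.blocks_sum]; omega)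

theorem isPartialSum_w {d : ℕ} (α : Composition d) {i : ℕ} (hi : i + 1 < d) :
    IsPartialSum (w α).blocks (i + 1) ↔ ¬ IsPartialSum α.blocks (d - 2 - i + 1) := by
  rw [w, isPartialSum_reverse_blocks _ hi, isPartialSum_complement _ (by omega)]

theorem w_w {d : ℕ} (α : Composition d) : w (w α) = α := by
  refine composition_ext_of_isPartialSum fun i hi => ?_
  rw [isPartialSum_w _ hi, isPartialSum_w _ (by omega), not_not,
    show d - 2 - (d - 2 - i) = i by omega]

/-! ### Splitting a composition -/

/-- Position `p` falls either between two parts or inside a part `a + b`. These are the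
concatenation and the almost concatenation. -/
theorem exists_split (l : List ℕ) (p : ℕ) (hp : p ≤ l.sum) :
    (∃ l₁ l₂, l = l₁ ++ l₂ ∧ l₁.sum = p) ∨
      ∃ l₁ a b l₂, 0 < a ∧ 0 < b ∧ l = l₁ ++ (a + b) :: l₂ ∧ l₁.sum + a = p := by
  induction l generalizing p with
  | nil => exact Or.inl ⟨[], [], rfl, (Nat.le_zero.1 hp).symm⟩
  | cons c l ih =>
    rw [List.sum_cons] at hp
    by_cases hc : c ≤ p
    · rcases ih (p - c) (by omega) with ⟨l₁, l₂, rfl, h⟩ | ⟨l₁, a, b, l₂, ha, hb, rfl, h⟩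
      · exact Or.inl ⟨c :: l₁, l₂, rfl, by rw [List.sum_cons]; omega⟩
      · exact Or.inr ⟨c :: l₁, a, b, l₂, ha, hb, rfl, by rw [List.sum_cons]; omega⟩
    · by_cases h0 : p = 0
      · exact Or.inl ⟨[], c :: l, rfl, h0.symm⟩
      · exact Or.inr ⟨[], p, c - p, l, by omega, by omega,
          by rw [Nat.add_sub_cancel' (by omega)]; rfl, by simp⟩

theorem exists_isConcat {p q : ℕ} (α : Composition (p + q)) :
    ∃ (β : Composition p) (γ : Composition q), IsConcat β γ α := by
  have hsum := α.blocks_sum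
  rcases exists_split α.blocks p (by omega) with ⟨l₁, l₂, h, h'⟩ | ⟨l₁, a, b, l₂, ha, hb, h, h'⟩
  · have hpos : ∀ i ∈ l₁ ++ l₂, 0 < i := fun i hi => α.blocks_pos (by rwa [h])
    rw [h, List.sum_append] at hsum
    exact ⟨⟨l₁, fun hi => hpos _ (List.mem_append_left _ hi), h'⟩,
      ⟨l₂, fun hi => hpos _ (List.mem_append_right _ hi), by omega⟩, Or.inl h⟩
  · have hpos : ∀ i ∈ l₁ ++ (a + b) :: l₂, 0 < i := fun i hi => α.blocks_pos (by rwa [h])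
    simp only [h, List.sum_append, List.sum_cons] at hsum
    refine ⟨⟨l₁ ++ [a], fun {i} hi => ?_, by simpa using h'⟩, ⟨b :: l₂, fun {i} hi => ?_, ?_⟩,
      Or.inr ⟨l₁, l₂, a, b, rfl, rfl, h⟩⟩
    · rcases List.mem_append.1 hi with hi | hi
      · exact hpos _ (List.mem_append_left _ hi)
      · rw [List.mem_singleton.1 hi]; exact ha
    · rcases List.mem_cons.1 hi with hi | hi
      · rw [hi]; exact hb
      · exact hpos _ (List.mem_append_right _ (List.mem_cons_of_mem _ hi))
    · rw [List.sum_cons]; omega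

/-- The two kinds of concatenation differ only in whether `p` is a partial sum of `α`. Away from
`p`, the partial sums of `β` and of the shifted `γ` are those of `α`, which also forces uniqueness
of the pair. -/
theorem IsConcat.isPartialSum_left {p q d : ℕ} {β : Composition p} {γ : Composition q}
    {α : Composition d} (h : IsConcat β γ α) {i : ℕ} (hi : i < p) :
    IsPartialSum β.blocks i ↔ IsPartialSum α.blocks i := by
  have hβ := β.blocks_sum
  rcases h with h | ⟨l, r, a, b, h1, h2, h⟩
  · rw [h, isPartialSum_append]
    refine ⟨Or.inl, ?_⟩
    rintro (h | ⟨t, rfl, -⟩)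
    · exact h
    · omega
  · rw [h1, List.sum_append, List.sum_singleton] at hβ
    rw [h1, h, isPartialSum_append, isPartialSum_append]
    refine or_congr Iff.rfl (exists_congr fun t => and_congr_right fun ht => ?_)
    rw [isPartialSum_cons, isPartialSum_cons]
    refine or_congr Iff.rfl (iff_of_false ?_ ?_)
    · rintro ⟨s, rfl, -⟩; omega
    · rintro ⟨s, rfl, -⟩; omega

theorem IsConcat.isPartialSum_right {p q d : ℕ} {β : Composition p} {γ : Composition q}
    {α : Composition d} (h : IsConcat β γ α) {i : ℕ} (hi : 0 < i) :
    IsPartialSum γ.blocks i ↔ IsPartialSum α.blocks (p + i) := by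
  have hβ := β.blocks_sum
  rcases h with h | ⟨l, r, a, b, h1, h2, h⟩
  · rw [h, isPartialSum_append, hβ]
    constructor
    · exact fun h => Or.inr ⟨i, rfl, h⟩
    · rintro (h | ⟨t, ht, h⟩)
      · have := h.le_sum; omega
      · rwa [show i = t by omega]
  · rw [h1, List.sum_append, List.sum_singleton] at hβ
    rw [h2, h, isPartialSum_append, isPartialSum_cons]
    simp only [isPartialSum_cons]
    constructor
    · rintro (h | ⟨t, rfl, h⟩)
      · omega
      · exact Or.inr ⟨a + b + t, by omega, Or.inr ⟨t, rfl, h⟩⟩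
    · rintro (h | ⟨t, ht, rfl | ⟨s, rfl, h⟩⟩)
      · have := h.le_sum; omega
      · omega
      · exact Or.inr ⟨s, by omega, h⟩

theorem IsConcat.unique {p q d : ℕ} {β β' : Composition p} {γ γ' : Composition q}
    {α : Composition d} (h : IsConcat β γ α) (h' : IsConcat β' γ' α) : β = β' ∧ γ = γ' :=
  ⟨composition_ext_of_isPartialSum fun i hi => by
      rw [h.isPartialSum_left hi, h'.isPartialSum_left hi],
    composition_ext_of_isPartialSum fun i hi => by
      rw [h.isPartialSum_right i.succ_pos, h'.isPartialSum_right i.succ_pos]⟩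

open Classical in
theorem sum_isConcat {N : Type*} [AddCommMonoid N] {p q d : ℕ} {β : Composition p}
    {γ : Composition q} {α : Composition d} (h : IsConcat β γ α)
    (G : Composition p → Composition q → N) :
    (∑ β', ∑ γ', if IsConcat β' γ' α then G β' γ' else 0) = G β γ := by
  rw [Finset.sum_eq_single_of_mem β (mem_univ _), Finset.sum_eq_single_of_mem γ (mem_univ _),
    if_pos h]
  · exact fun γ' _ hne => if_neg fun h' => hne (h'.unique h).2
  · exact fun β' _ hne => Finset.sum_eq_zero fun γ' _ => if_neg fun h' => hne (h'.unique h).1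

/-! ### Fundamental quasisymmetric functions as generating functions of words -/

theorem lt_sizeUpTo_index_add_one {d : ℕ} (α : Composition d) (j : Fin d) :
    (j : ℕ) < α.sizeUpTo ((α.index j : ℕ) + 1) := α.lt_sizeUpTo_index_succ j

theorem index_mono {d : ℕ} (α : Composition d) : Monotone α.index := by
  intro x y hxy
  by_contra h
  have h1 := lt_sizeUpTo_index_add_one α y
  have h2 := α.sizeUpTo_index_le x
  have h3 := α.monotone_sizeUpTo (show (α.index y : ℕ) + 1 ≤ α.index x from not_le.1 h)
  have : (x : ℕ) ≤ y := hxy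
  omega

theorem isPartialSum_iff_index_lt {d : ℕ} (α : Composition d) {i : ℕ} (hi : i + 1 < d) :
    IsPartialSum α.blocks (i + 1) ↔ α.index ⟨i, by omega⟩ < α.index ⟨i + 1, hi⟩ := by
  have h1 := lt_sizeUpTo_index_add_one α ⟨i, by omega⟩
  have h2 := α.sizeUpTo_index_le ⟨i, by omega⟩
  have h3 := lt_sizeUpTo_index_add_one α ⟨i + 1, hi⟩
  have h4 := α.sizeUpTo_index_le ⟨i + 1, hi⟩
  simp only at h1 h2 h3 h4
  constructor
  · rintro ⟨k, hk⟩
    have hk' : α.sizeUpTo k = i + 1 := hk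
    refine lt_of_lt_of_le (b := (k : ℕ)) ?_ ?_ |> Fin.lt_def.2
    · by_contra h
      have := α.monotone_sizeUpTo (not_lt.1 h)
      omega
    · by_contra h
      have := α.monotone_sizeUpTo (show (α.index ⟨i + 1, hi⟩ : ℕ) + 1 ≤ k from not_le.1 h)
      omega
  · intro h
    refine ⟨(α.index ⟨i, by omega⟩ : ℕ) + 1, ?_⟩
    have h5 := α.monotone_sizeUpTo (show (α.index ⟨i, by omega⟩ : ℕ) + 1 ≤ _ from h)
    change α.sizeUpTo _ = i + 1
    omega

theorem Chain.monotone {d : ℕ} {R : ℕ → ℕ → ℕ → Prop} {u : Fin d → ℕ} (h : Chain R u)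
    (hR : ∀ i a b, R i a b → a ≤ b) : Monotone u := by
  rcases d with _ | d
  · exact fun x => x.elim0
  · exact Fin.monotone_iff_le_succ.2 fun i => hR _ _ _ (h i (by omega))

/-- Weakly increasing, with strict increases exactly at the positions described by `P`. -/
def exactRel (P : ℕ → Prop) : ℕ → ℕ → ℕ → Prop := fun i a b => a ≤ b ∧ (P (i + 1) ↔ a < b)

/-- Weakly increasing, with strict increases at least at the positions described by `P`. -/
def ascRel (P : ℕ → Prop) : ℕ → ℕ → ℕ → Prop := fun i a b => a ≤ b ∧ (P (i + 1) → a < b)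

/-- Such a word is constant on each block of `α` and rises strictly between blocks, hence amounts to
a strictly increasing choice of one variable per block. -/
theorem chain_exactRel_iff {d : ℕ} (α : Composition d) (u : Fin d → ℕ) :
    Chain (exactRel (IsPartialSum α.blocks)) u ↔
      ∃ i : Fin α.length → ℕ, StrictMono i ∧ u = i ∘ α.index := by
  constructor
  · intro h
    have hmono : Monotone u := h.monotone fun _ _ _ h => h.1
    have hlt : ∀ x y : Fin d, α.index x < α.index y → u x < u y := by
      intro x y hxy
      by_contra hc
      -- Without a rise, `u` is constant from `x` to `y`, so no step between them crosses a block
      -- boundary and the index is constant too, a contradiction.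
      have hle : ∀ z, x ≤ z → z ≤ y → u z = u x := fun z h1 h2 =>
        le_antisymm ((hmono h2).trans (not_lt.1 hc)) (hmono h1)
      have hxy' : (x : ℕ) ≤ y := by
        by_contra h'
        exact absurd (index_mono α (show y ≤ x from (not_le.1 h').le)) (not_le.2 hxy)
      have key : ∀ k : ℕ, ∀ hk : (x : ℕ) + k ≤ y, α.index ⟨x + k, by omega⟩ = α.index x := by
        intro k
        induction k with
        | zero => intro _; rfl
        | succ k ih =>
          intro hk
          rw [← ih (by omega)]
          by_contra hne
          have h1 : α.index ⟨x + k, by omega⟩ < α.index ⟨x + k + 1, by omega⟩ :=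
            lt_of_le_of_ne (index_mono α (Fin.mk_le_mk.2 (by omega))) (Ne.symm hne)
          rw [← isPartialSum_iff_index_lt] at h1
          have h2 := (h (x + k) (by omega)).2.1 h1
          rw [hle ⟨x + k, _⟩ (Fin.le_def.2 (by simp)) (Fin.le_def.2 (by simp; omega)),
            hle ⟨x + k + 1, _⟩ (Fin.le_def.2 (by simp; omega))
              (Fin.le_def.2 (by simp; omega))] at h2
          exact lt_irrefl _ h2
      have := key (y - x) (by omega)
      simp only [Nat.add_sub_cancel' hxy'] at this
      exact hxy.ne this.symm
    have heq : ∀ x y : Fin d, x ≤ y → α.index x = α.index y → u x = u y := by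
      intro x y hxy hidx
      have hxy' : (x : ℕ) ≤ y := hxy
      have key : ∀ k : ℕ, ∀ hk : (x : ℕ) + k ≤ y, u ⟨x + k, by omega⟩ = u x := by
        intro k
        induction k with
        | zero => intro _; rfl
        | succ k ih =>
          intro hk
          rw [← ih (by omega)]
          have h0 := h (x + k) (by omega)
          refine le_antisymm (not_lt.1 fun h1 => ?_) h0.1
          replace h1 := h0.2.2 h1
          rw [isPartialSum_iff_index_lt _ (by omega)] at h1
          refine absurd h1 (not_lt.2 ?_)
          calc _ ≤ α.index y := index_mono α (Fin.le_def.2 (by simp; omega))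
            _ = α.index x := hidx.symm
            _ ≤ _ := index_mono α (Fin.le_def.2 (by simp))
      have := key (y - x) (by omega)
      simp only [Nat.add_sub_cancel' hxy'] at this
      exact this.symm
    have hidx : ∀ a : Fin α.length, α.index (α.embedding a ⟨0, α.blocks_pos' a a.2⟩) = a :=
      fun a => α.index_embedding a _
    refine ⟨fun a => u (α.embedding a ⟨0, α.blocks_pos' a a.2⟩), fun a b hab => ?_, ?_⟩
    · exact hlt _ _ (by rwa [hidx, hidx])
    · funext x
      rcases le_total x (α.embedding (α.index x) ⟨0, α.blocks_pos' _ (α.index x).2⟩) with h | h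
      · exact heq _ _ h (hidx _).symm
      · exact (heq _ _ h (hidx _)).symm
  · rintro ⟨i, hi, rfl⟩ k hk
    refine ⟨hi.monotone (index_mono α (Fin.le_def.2 (by simp))), ?_⟩
    rw [isPartialSum_iff_index_lt _ hk]
    exact hi.lt_iff_lt.symm

theorem wt_comp_index {d : ℕ} (α : Composition d) (i : Fin α.length → ℕ) :
    wt (i ∘ α.index) = ∑ j, Finsupp.single (i j) (α.blocksFun j) := by
  rw [wt, ← Equiv.sum_comp α.blocksFinEquiv, Fintype.sum_sigma]
  refine Finset.sum_congr rfl fun j _ => ?_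
  have : ∀ k, (i ∘ α.index) (α.blocksFinEquiv ⟨j, k⟩) = i j := fun k =>
    congrArg i (α.index_embedding j k)
  simp_rw [this]
  simp

theorem support_sum_single {k : ℕ} (i : Fin k → ℕ) (a : Fin k → ℕ) (ha : ∀ j, 0 < a j) :
    ((∑ j, Finsupp.single (i j) (a j)).support : Set ℕ) = Set.range i := by
  ext x
  rw [Finset.mem_coe, Finsupp.mem_support_iff, Finsupp.finsetSum_apply, Ne,
    Finset.sum_eq_zero_iff]
  simp only [mem_univ, true_implies, Finsupp.single_apply, Set.mem_range]
  constructor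
  · intro h
    by_contra hne
    exact h fun j => if_neg fun h' => hne ⟨j, h'⟩
  · rintro ⟨j, rfl⟩ h
    have := h j
    rw [if_pos rfl] at this
    exact (ha j).ne' this

theorem exists_sum_single {d : ℕ} (α : Composition d) {m : ℕ →₀ ℕ} (h : exponents m = α.blocks) :
    ∃ i : Fin α.length → ℕ, StrictMono i ∧ ∑ j, Finsupp.single (i j) (α.blocksFun j) = m := by
  have hlen : m.support.card = α.length := by
    have := congrArg List.length h
    rwa [exponents, List.length_map, Finset.length_sort] at this
  have hval : ∀ j, m (m.support.orderEmbOfFin hlen j) = α.blocksFun j := by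
    intro j
    rw [Finset.orderEmbOfFin_apply, Composition.blocksFun]
    simp [← h, exponents]
  refine ⟨m.support.orderEmbOfFin hlen, (m.support.orderEmbOfFin hlen).strictMono, ?_⟩
  conv_rhs => rw [← Finsupp.sum_single m]
  rw [Finsupp.sum]
  refine Finset.sum_bij' (fun j _ => m.support.orderEmbOfFin hlen j)
    (fun x hx => (m.support.orderIsoOfFin hlen).symm ⟨x, hx⟩) ?_ ?_ ?_ ?_ ?_
  · exact fun j _ => Finset.orderEmbOfFin_mem _ _ _
  · exact fun _ _ => mem_univ _
  · intro j _
    rw [OrderIso.symm_apply_eq]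
    rfl
  · intro x hx
    rw [← Finset.coe_orderIsoOfFin_apply, OrderIso.apply_symm_apply]
  · intro j _
    rw [hval]

theorem coeff_M {d : ℕ} (α : Composition d) (m : ℕ →₀ ℕ) :
    MvPowerSeries.coeff m (M α : MvPowerSeries ℕ ℚ) =
      if exponents m = α.blocks then 1 else 0 := rfl

open Classical in
theorem M_eq_chainGen {d : ℕ} (α : Composition d) :
    (M α : MvPowerSeries ℕ ℚ) = chainGen d (exactRel (IsPartialSum α.blocks)) := by
  ext m
  rw [coeff_M, chainGen, coeff_gen]
  have hexp : ∀ i : Fin α.length → ℕ, StrictMono i →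
      exponents (∑ j, Finsupp.single (i j) (α.blocksFun j)) = α.blocks := fun i hi => by
    rw [exponents_sum_single i hi _ fun j => α.one_le_blocksFun j, α.ofFn_blocksFun]
  split_ifs with h
  · obtain ⟨i, hi, rfl⟩ := exists_sum_single α h
    rw [Finset.sum_eq_single_of_mem (i ∘ α.index) (by rw [mem_words, wt_comp_index]),
      if_pos ((chain_exactRel_iff α _).2 ⟨i, hi, rfl⟩)]
    intro u hu hne
    rw [if_neg]
    intro hc
    obtain ⟨i', hi', rfl⟩ := (chain_exactRel_iff α _).1 hc
    rw [mem_words, wt_comp_index] at hu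
    apply hne
    congr 1
    -- A strictly increasing sequence is determined by its range, here the support of the exponent
    -- vector; so at most one word has this weight.
    have := congrArg (fun m : ℕ →₀ ℕ => (m.support : Set ℕ)) hu
    beta_reduce at this
    rw [support_sum_single _ _ fun j => α.one_le_blocksFun j,
      support_sum_single _ _ fun j => α.one_le_blocksFun j] at this
    exact (hi'.range_inj hi).1 this
  · symm
    refine Finset.sum_eq_zero fun u hu => if_neg fun hc => h ?_
    obtain ⟨i', hi', rfl⟩ := (chain_exactRel_iff α _).1 hc
    rw [mem_words, wt_comp_index] at hu
    rw [← hu, hexp i' hi']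

theorem refines_iff {d : ℕ} (β α : Composition d) :
    Refines β α ↔
      ∀ i, i + 1 < d → IsPartialSum α.blocks (i + 1) → IsPartialSum β.blocks (i + 1) := by
  constructor
  · intro h i hi hα
    exact (mem_boundaries_iff β ⟨i + 1, by omega⟩).1 (h ((mem_boundaries_iff _ _).2 hα))
  · intro h x hx
    rw [mem_boundaries_iff] at hx ⊢
    obtain ⟨_ | x, hx'⟩ := x
    · exact isPartialSum_zero _
    · rcases Nat.lt_or_ge (x + 1) d with h' | h'
      · exact h x h' hx
      · obtain rfl : d = x + 1 := by omega
        exact isPartialSum_total _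

/-- A weakly increasing word belongs to exactly one `M β`, with `β` recording its strict rises; it
rises at all partial sums of `α` precisely when `β` refines `α`. -/
theorem F_eq_chainGen {d : ℕ} (α : Composition d) :
    (F α : MvPowerSeries ℕ ℚ) = chainGen d (ascRel (IsPartialSum α.blocks)) := by
  classical
  rw [F, AddSubmonoidClass.coe_finsetSum]
  simp_rw [M_eq_chainGen, chainGen]
  rw [← map_sum]
  congr 1
  funext u
  rw [Finset.sum_apply]
  split_ifs with h
  · have hmono : Monotone u := h.monotone fun _ _ _ h => h.1
    set β := ofPred d fun s => ∃ hs : s < d, u ⟨s - 1, by omega⟩ < u ⟨s, hs⟩ with hβ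
    have hβ' : ∀ i (hi : i + 1 < d), IsPartialSum β.blocks (i + 1) ↔
        u ⟨i, by omega⟩ < u ⟨i + 1, hi⟩ := fun i hi => by
      rw [hβ, isPartialSum_ofPred _ hi]
      exact ⟨fun ⟨_, h⟩ => h, fun h => ⟨hi, h⟩⟩
    rw [Finset.sum_eq_single_of_mem β, if_pos]
    · exact fun i hi => ⟨(h i hi).1, hβ' i hi⟩
    · rw [mem_filter, refines_iff]
      exact ⟨mem_univ _, fun i hi hα => (hβ' i hi).2 ((h i hi).2 hα)⟩
    · intro γ _ hne
      refine if_neg fun hγ => hne (composition_ext_of_isPartialSum fun i hi => ?_)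
      rw [hβ' i hi, (hγ i hi).2]
  · refine Finset.sum_eq_zero fun β hβ => if_neg fun hc => h fun i hi => ⟨(hc i hi).1, fun hα => ?_⟩
    rw [mem_filter, refines_iff] at hβ
    exact (hc i hi).2.1 (hβ.2 i hi hα)

/-! ### The fundamental basis -/

/-- The exponent vector of `x₁^{α₁} ⋯ x_k^{α_k}`. -/
def leadingExponent {d : ℕ} (α : Composition d) : ℕ →₀ ℕ :=
  ∑ j : Fin α.length, Finsupp.single (j : ℕ) (α.blocksFun j)

theorem exponents_leadingExponent {d : ℕ} (α : Composition d) :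
    exponents (leadingExponent α) = α.blocks := by
  rw [leadingExponent, exponents_sum_single (fun j : Fin α.length => (j : ℕ)) (fun _ _ h => h) _
    fun j => α.one_le_blocksFun j, α.ofFn_blocksFun]

open Classical in
theorem coeff_F {d : ℕ} (α : Composition d) (m : ℕ →₀ ℕ) :
    MvPowerSeries.coeff m (F α : MvPowerSeries ℕ ℚ) =
      ∑ β : Composition d with Refines β α, if exponents m = β.blocks then 1 else 0 := by
  rw [F, AddSubmonoidClass.coe_finsetSum, map_sum]
  rfl

theorem coeff_leadingExponent_F_self {d : ℕ} (α : Composition d) :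
    MvPowerSeries.coeff (leadingExponent α) (F α : MvPowerSeries ℕ ℚ) = 1 := by
  classical
  rw [coeff_F, exponents_leadingExponent, Finset.sum_eq_single_of_mem α, if_pos rfl]
  · exact mem_filter.2 ⟨mem_univ _, Finset.Subset.refl _⟩
  · exact fun β _ hne => if_neg fun h => hne (Composition.ext h.symm)

theorem refines_of_coeff_F_ne_zero {d : ℕ} {α : Composition d} {m : ℕ →₀ ℕ}
    (h : MvPowerSeries.coeff m (F α : MvPowerSeries ℕ ℚ) ≠ 0) :
    ∃ β : Composition d, Refines β α ∧ exponents m = β.blocks := by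
  classical
  rw [coeff_F] at h
  obtain ⟨β, hβ, h⟩ := Finset.exists_ne_zero_of_sum_ne_zero h
  exact ⟨β, (mem_filter.1 hβ).2, by_contra fun h' => h (if_neg h')⟩

theorem Refines.length_le {d : ℕ} {β α : Composition d} (h : Refines β α) :
    α.length ≤ β.length := by
  have := Finset.card_le_card h
  rw [α.card_boundaries_eq_succ_length, β.card_boundaries_eq_succ_length] at this
  omega

theorem Refines.eq_of_length_le {d : ℕ} {β α : Composition d} (h : Refines β α)
    (hl : β.length ≤ α.length) : β = α := by
  refine (Composition.boundaries_injective (Finset.eq_of_subset_of_card_le h ?_)).symm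
  rw [α.card_boundaries_eq_succ_length, β.card_boundaries_eq_succ_length]
  omega

/-- Triangularity: among the terms with nonzero coefficient, pick `α` with fewest parts. If `F β`
contains the leading monomial of `α`, then `α` refines `β`, so `β` has no more parts than `α` and
minimality forces `β = α`. -/
theorem linearIndependent_F :
    LinearIndependent ℚ fun x : Σ d, Composition d => F x.2 := by
  classical
  rw [linearIndependent_iff']
  intro s c hsum x hx
  by_contra hcx
  obtain ⟨⟨d, α⟩, hα, hmin⟩ := (s.filter fun x => c x ≠ 0).exists_min_image
    (fun x => x.2.length) ⟨x, mem_filter.2 ⟨hx, hcx⟩⟩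
  rw [mem_filter] at hα
  have h0 := congrArg (fun f : QSym => MvPowerSeries.coeff (leadingExponent α) f.1) hsum
  simp only [AddSubmonoidClass.coe_finsetSum, Submodule.coe_smul, map_sum, map_smul, smul_eq_mul,
    ZeroMemClass.coe_zero, map_zero] at h0
  rw [Finset.sum_eq_single_of_mem _ hα.1, coeff_leadingExponent_F_self, mul_one] at h0
  · exact hα.2 h0
  · rintro ⟨e, β⟩ hβ hne
    by_contra hprod
    obtain ⟨hcβ, hF⟩ := mul_ne_zero_iff.1 hprod
    obtain ⟨γ, hγ, hexp⟩ := refines_of_coeff_F_ne_zero hF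
    rw [exponents_leadingExponent] at hexp
    obtain rfl : d = e := α.blocks_sum.symm.trans ((congrArg List.sum hexp).trans γ.blocks_sum)
    obtain rfl : α = γ := Composition.ext hexp
    have hle : α.length ≤ β.length := hmin ⟨d, β⟩ (mem_filter.2 ⟨hβ, hcβ⟩)
    exact hne (by rw [hγ.eq_of_length_le hle])

/-- `M α` is `F α` minus the `M β` for strictly finer `β`. These have more parts, and the number of
parts is at most `d`, so the induction terminates. -/
theorem M_mem_span_F {d : ℕ} (α : Composition d) :
    M α ∈ Submodule.span ℚ (Set.range fun x : Σ d, Composition d => F x.2) := by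
  classical
  induction hn : d - α.length using Nat.strong_induction_on generalizing α with
  | _ n ih =>
    have hα : α ∈ univ.filter fun β => Refines β α :=
      mem_filter.2 ⟨mem_univ _, Finset.Subset.refl _⟩
    have hF : M α = F α - ∑ β ∈ (univ.filter fun β => Refines β α).erase α, M β := by
      rw [F, ← Finset.add_sum_erase _ _ hα]
      simp
    rw [hF]
    refine Submodule.sub_mem _ (Submodule.subset_span ⟨⟨d, α⟩, rfl⟩)
      (Submodule.sum_mem _ fun β hβ => ?_)
    rw [mem_erase, mem_filter] at hβ
    have h1 : α.length < β.length := by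
      by_contra h
      exact hβ.1 (hβ.2.2.eq_of_length_le (not_lt.1 h))
    have h2 := β.length_le
    exact ih _ (by omega) β rfl

theorem eq_sum_M {f : MvPowerSeries ℕ ℚ} (hf : f ∈ QSym) : ∃ D : ℕ,
    (⟨f, hf⟩ : QSym) = ∑ d ∈ range (D + 1), ∑ α : Composition d,
      MvPowerSeries.coeff (leadingExponent α) f • M α := by
  obtain ⟨⟨D, hD⟩, hq⟩ := id hf
  refine ⟨D, Subtype.ext ?_⟩
  simp only [AddSubmonoidClass.coe_finsetSum, Submodule.coe_smul]
  ext m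
  simp only [map_sum, map_smul, coeff_M, smul_eq_mul]
  by_cases hm : m.degree ≤ D
  · set α : Composition m.degree := ⟨exponents m, fun {i} hi => by
      rw [exponents, List.mem_map] at hi
      obtain ⟨x, hx, rfl⟩ := hi
      rw [Finset.mem_sort, Finsupp.mem_support_iff] at hx
      exact Nat.pos_of_ne_zero hx, sum_exponents m⟩
    rw [Finset.sum_eq_single_of_mem m.degree (mem_range.2 (by omega)),
      Finset.sum_eq_single_of_mem α (mem_univ _), if_pos rfl, mul_one]
    · obtain ⟨i, hi, h⟩ := exists_sum_single α rfl
      rw [leadingExponent, ← hq _ α i hi, h]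
    · exact fun β _ hne => by rw [if_neg fun h => hne (Composition.ext h.symm), mul_zero]
    · intro d _ hne
      refine Finset.sum_eq_zero fun β _ => ?_
      rw [if_neg, mul_zero]
      intro h
      exact hne (by rw [← β.blocks_sum, ← h, sum_exponents])
  · rw [Finset.sum_eq_zero]
    · by_contra h
      exact hm (hD m h)
    · intro d hd
      rw [mem_range] at hd
      refine Finset.sum_eq_zero fun β _ => ?_
      rw [if_neg, mul_zero]
      intro h
      have := β.blocks_sum
      rw [← h, sum_exponents] at this
      omega

/-- The basis of fundamental quasisymmetric functions. -/
def basisF : Module.Basis (Σ d, Composition d) ℚ QSym :=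
  Module.Basis.mk linearIndependent_F <| by
    rintro ⟨f, hf⟩ -
    obtain ⟨D, h⟩ := eq_sum_M hf
    rw [h]
    exact Submodule.sum_mem _ fun d _ => Submodule.sum_mem _ fun α _ =>
      Submodule.smul_mem _ _ (M_mem_span_F α)

theorem basisF_apply {d : ℕ} (α : Composition d) : basisF ⟨d, α⟩ = F α := by
  rw [basisF, Module.Basis.mk_apply]

theorem hom_ext_F {f g : QSym →ₗ[ℚ] QSym}
    (h : ∀ (d : ℕ) (α : Composition d), f (F α) = g (F α)) : f = g :=
  basisF.ext fun ⟨d, α⟩ => by rw [basisF_apply, h]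

/-! ### The antipode -/

/-- Failing `a ≤ b` with a forced rise at partial sums means `b ≤ a` at partial sums and `b < a`
elsewhere. Read backwards, this is weak increase with strictness at the complementary positions. -/
theorem F_w_eq_chainGen {d : ℕ} (α : Composition d) :
    (F (w α) : MvPowerSeries ℕ ℚ) =
      chainGen d fun i a b => ¬ ascRel (IsPartialSum α.blocks) i a b := by
  rw [F_eq_chainGen, chainGen_rev]
  refine chainGen_congr fun i a b hi => ?_
  rw [ascRel, ascRel, isPartialSum_w _ (by omega), show d - 2 - (d - 2 - i) = i by omega]
  by_cases h : IsPartialSum α.blocks (i + 1)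
  · simp only [h, not_true, false_implies, true_implies, and_true]
    omega
  · simp only [h, not_false_eq_true, false_implies, true_implies, and_true]
    omega

theorem exists_isConcat_mul {p q d : ℕ} (hd : p + q = d) (α : Composition d) :
    ∃ (β : Composition p) (γ : Composition q), IsConcat β γ α ∧
      (F (w β) : MvPowerSeries ℕ ℚ) * F γ =
        chainGen d (cut p (fun i a b => ¬ ascRel (IsPartialSum α.blocks) i a b)
          fun i => ascRel (IsPartialSum α.blocks) (i + p)) ∧
      (F β : MvPowerSeries ℕ ℚ) * F (w γ) =
        chainGen d (cut p (ascRel (IsPartialSum α.blocks))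
          fun i a b => ¬ ascRel (IsPartialSum α.blocks) (i + p) a b) := by
  subst hd
  obtain ⟨β, γ, h⟩ := exists_isConcat α
  have hl : ∀ i a b, i + 1 < p → (ascRel (IsPartialSum β.blocks) i a b ↔
      ascRel (IsPartialSum α.blocks) i a b) := fun i a b hi => by
    rw [ascRel, ascRel, h.isPartialSum_left hi]
  have hr : ∀ i a b, ascRel (IsPartialSum γ.blocks) i a b ↔
      ascRel (IsPartialSum α.blocks) (i + p) a b := fun i a b => by
    rw [ascRel, ascRel, h.isPartialSum_right i.succ_pos, show p + (i + 1) = i + p + 1 by ring]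
  refine ⟨β, γ, h, ?_, ?_⟩
  · rw [F_w_eq_chainGen, F_eq_chainGen, chainGen_mul]
    refine chainGen_congr fun i a b _ => and_congr (forall_congr' fun hi => ?_)
      (forall_congr' fun hi => hr _ _ _)
    exact not_congr (hl _ _ _ hi)
  · rw [F_w_eq_chainGen, F_eq_chainGen, chainGen_mul]
    refine chainGen_congr fun i a b _ => and_congr (forall_congr' fun hi => hl _ _ _ hi)
      (forall_congr' fun hi => not_congr (hr _ _ _))

/-- The linear map with `F_α ↦ (-1)^{|α|} F_{w(α)}`. -/
def antipode : QSym →ₗ[ℚ] QSym := basisF.constr ℚ fun x => (-1 : ℚ) ^ x.1 • F (w x.2)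

theorem antipode_F {d : ℕ} (α : Composition d) : antipode (F α) = (-1 : ℚ) ^ d • F (w α) := by
  rw [antipode, ← basisF_apply, Module.Basis.constr_basis]

theorem isAntipode_antipode : IsAntipode antipode := by
  classical
  intro d α
  choose β γ hc h1 h2 using fun p : antidiagonal d =>
    exists_isConcat_mul (HasAntidiagonal.mem_antidiagonal.1 p.2) α
  constructor
  · calc _ = ∑ p ∈ antidiagonal d, (-1 : ℚ) ^ p.1 • chainGen d (cut p.1
          (fun i a b => ¬ ascRel (IsPartialSum α.blocks) i a b)
          fun i => ascRel (IsPartialSum α.blocks) (i + p.1)) := by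
          refine Finset.sum_congr rfl fun p hp => ?_
          rw [sum_isConcat (hc ⟨p, hp⟩), antipode_F, Submodule.coe_smul, smul_mul_assoc, h1]
      _ = _ := by
          rw [Finset.Nat.sum_antidiagonal_eq_sum_range_succ_mk]
          split_ifs with h0
          · subst h0
            simp [chainGen_zero]
          · exact sum_chainGen_cut (Nat.pos_of_ne_zero h0) _ _ fun i a b => not_not.symm
  · calc _ = ∑ p ∈ antidiagonal d, (-1 : ℚ) ^ d • (-1 : ℚ) ^ p.1 • chainGen d (cut p.1
          (ascRel (IsPartialSum α.blocks))
          fun i a b => ¬ ascRel (IsPartialSum α.blocks) (i + p.1) a b) := by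
          refine Finset.sum_congr rfl fun p hp => ?_
          -- Here `S` acts on the right factor and contributes `(-1)^q`; extracting the constant
          -- `(-1)^d` leaves the sign `(-1)^p` of the cancellation lemma.
          have hs : (-1 : ℚ) ^ d * (-1) ^ p.1 = (-1) ^ p.2 := by
            rw [← HasAntidiagonal.mem_antidiagonal.1 hp, ← pow_add,
              show p.1 + p.2 + p.1 = 2 * p.1 + p.2 by ring, pow_add, pow_mul]
            simp
          rw [sum_isConcat (hc ⟨p, hp⟩), antipode_F, Submodule.coe_smul, mul_smul_comm, h2,
            smul_smul, hs]
      _ = _ := by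
          rw [← Finset.smul_sum, Finset.Nat.sum_antidiagonal_eq_sum_range_succ_mk]
          split_ifs with h0
          · subst h0
            simp [chainGen_zero]
          · rw [sum_chainGen_cut (Nat.pos_of_ne_zero h0) _
              (fun i a b => ¬ ascRel (IsPartialSum α.blocks) i a b) fun i a b => Iff.rfl, smul_zero]

theorem IsAntipode.unique {S S' : QSym →ₗ[ℚ] QSym} (h : IsAntipode S) (h' : IsAntipode S') :
    S = S' := by
  classical
  refine hom_ext_F fun d => ?_
  induction d using Nat.strong_induction_on with
  | _ d ih =>
    intro α
    have heq := (h d α).1.trans (h' d α).1.symm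
    -- The term `(d, 0)` is `S (F α)` times `F ∅ = 1`; all other terms involve `S` only in degrees
    -- below `d`. The left inverse identity alone therefore determines `S`.
    have hd : (d, 0) ∈ antidiagonal d := by simp
    rw [← Finset.add_sum_erase _ _ hd, ← Finset.add_sum_erase _ _ hd] at heq
    rw [Finset.sum_congr rfl (g := fun p : ℕ × ℕ => ∑ β : Composition p.1, ∑ γ : Composition p.2,
      (if IsConcat β γ α then (S' (F β) : MvPowerSeries ℕ ℚ) * (F γ : MvPowerSeries ℕ ℚ) else 0))
      fun p hp => ?_] at heq
    · have hc : IsConcat α (Composition.ones 0) α := Or.inl (by simp)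
      have heq' := add_right_cancel heq
      rw [sum_isConcat hc, sum_isConcat hc, F_eq_chainGen (Composition.ones 0),
        chainGen_zero, mul_one, mul_one] at heq'
      exact Subtype.ext heq'
    · rw [mem_erase, HasAntidiagonal.mem_antidiagonal] at hp
      have hlt : p.1 < d := by
        refine lt_of_le_of_ne (by omega) fun h1 => hp.1 (Prod.ext h1 ?_)
        simp only
        omega
      refine Finset.sum_congr rfl fun β _ => Finset.sum_congr rfl fun γ _ => ?_
      rw [ih p.1 hlt]

theorem isOmega_iff {ω : QSym →ₗ[ℚ] QSym} :
    IsOmega ω ↔ ∀ (d : ℕ) (α : Composition d), ω (F α) = F (w α) := by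
  have hsq : ∀ (d : ℕ) (f : QSym), (-1 : ℚ) ^ d • (-1 : ℚ) ^ d • f = f := fun d f => by
    rw [smul_smul, ← pow_add, ← two_mul, pow_mul]
    simp
  constructor
  · rintro ⟨S, hS, h⟩ d α
    rw [h, hS.unique isAntipode_antipode, antipode_F, hsq]
  · exact fun h => ⟨antipode, isAntipode_antipode, fun d α => by rw [h, antipode_F, hsq]⟩

theorem existsUnique_isOmega : ∃! ω : QSym →ₗ[ℚ] QSym, IsOmega ω := by
  refine ⟨basisF.constr ℚ fun x => F (w x.2), isOmega_iff.2 fun d α => ?_, fun ω h => ?_⟩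
  · rw [← basisF_apply, Module.Basis.constr_basis]
  · refine hom_ext_F fun d α => ?_
    rw [isOmega_iff.1 h, ← basisF_apply α, Module.Basis.constr_basis]

theorem IsOmega.involutive {ω : QSym →ₗ[ℚ] QSym} (h : IsOmega ω) : Function.Involutive ω := by
  have : ω ∘ₗ ω = LinearMap.id := hom_ext_F fun d α => by
    rw [LinearMap.comp_apply, isOmega_iff.1 h, isOmega_iff.1 h, w_w, LinearMap.id_apply]
  exact fun f => LinearMap.congr_fun this f

/-! ### Reversal of the variables -/

theorem wt_comp {d : ℕ} (ρ : ℕ → ℕ) (u : Fin d → ℕ) : wt (ρ ∘ u) = (wt u).mapDomain ρ := by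
  rw [wt, wt, Finsupp.mapDomain_finsetSum]
  simp_rw [Finsupp.mapDomain_single]
  rfl

theorem lt_of_wt_eq {d n : ℕ} {u : Fin d → ℕ} {m : Fin n →₀ ℕ}
    (h : wt u = m.mapDomain Fin.val) (x : Fin d) : u x < n := by
  classical
  have h1 : u x ∈ (wt u).support := by
    rw [Finsupp.mem_support_iff, wt, Finsupp.finsetSum_apply]
    exact (Finset.sum_pos' (fun _ _ => Nat.zero_le _) ⟨x, mem_univ x, by simp⟩).ne'
  rw [h] at h1
  obtain ⟨y, -, hy⟩ := Finset.mem_image.1 (Finsupp.mapDomain_support h1)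
  exact hy ▸ y.2

theorem wt_sub_comp {d n : ℕ} {u : Fin d → ℕ} {m : Fin n →₀ ℕ}
    (h : wt u = m.mapDomain Fin.val) :
    wt ((fun x => n - 1 - x) ∘ u) = (m.mapDomain Fin.rev).mapDomain Fin.val := by
  rw [wt_comp, h, ← Finsupp.mapDomain_comp, ← Finsupp.mapDomain_comp]
  congr 1
  funext x
  simp only [Function.comp_apply, Fin.val_rev]
  omega

theorem coeff_inVars (n : ℕ) (f : MvPowerSeries ℕ ℚ) (m : Fin n →₀ ℕ) :
    MvPowerSeries.coeff m (inVars n f) = MvPowerSeries.coeff (m.mapDomain Fin.val) f := by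
  rw [inVars, MvPowerSeries.coeff_killCompl, Finsupp.embDomain_eq_mapDomain]
  rfl

theorem mapDomain_rev_rev {n : ℕ} (m : Fin n →₀ ℕ) :
    (m.mapDomain Fin.rev).mapDomain Fin.rev = m := by
  rw [← Finsupp.mapDomain_comp, Fin.rev_involutive.comp_self, Finsupp.mapDomain_id]

theorem coeff_inVarsRev (n : ℕ) (f : MvPowerSeries ℕ ℚ) (m : Fin n →₀ ℕ) :
    MvPowerSeries.coeff m (inVarsRev n f) =
      MvPowerSeries.coeff ((m.mapDomain Fin.rev).mapDomain Fin.val) f := by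
  rw [← coeff_inVars]
  have := MvPowerSeries.coeff_embDomain_rename (Fin.revPerm (n := n)).toEmbedding (inVars n f)
    (m.mapDomain Fin.rev)
  rw [← this, Finsupp.embDomain_eq_mapDomain]
  conv_lhs => rw [← mapDomain_rev_rev m]
  rfl

/-- Reversing the positions and replacing each letter `x` by `n - 1 - x` preserves weak and strict
increase while reflecting the set of forced rises. All letters are below `n`, so the truncated
subtraction is an involution here. -/
theorem inVars_F_reverse {d : ℕ} (n : ℕ) (α : Composition d) :
    inVars n (F α.reverse : MvPowerSeries ℕ ℚ) = inVarsRev n (F α) := by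
  classical
  ext m
  rw [coeff_inVars, coeff_inVarsRev, F_eq_chainGen, chainGen_rev, F_eq_chainGen, chainGen,
    chainGen, coeff_gen, coeff_gen]
  refine Finset.sum_bij' (fun u _ => (fun x => n - 1 - x) ∘ u)
    (fun u _ => (fun x => n - 1 - x) ∘ u) ?_ ?_ ?_ ?_ ?_
  · intro u hu
    rw [mem_words] at hu ⊢
    exact wt_sub_comp hu
  · intro u hu
    rw [mem_words] at hu ⊢
    rw [wt_sub_comp hu, mapDomain_rev_rev]
  · intro u hu
    funext x
    have := lt_of_wt_eq (mem_words.1 hu) x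
    simp only [Function.comp_apply]
    omega
  · intro u hu
    funext x
    have := lt_of_wt_eq (mem_words.1 hu) x
    simp only [Function.comp_apply]
    omega
  · intro u hu
    refine if_congr (forall₂_congr fun i hi => ?_) rfl rfl
    have h1 := lt_of_wt_eq (mem_words.1 hu) ⟨i, by omega⟩
    have h2 := lt_of_wt_eq (mem_words.1 hu) ⟨i + 1, hi⟩
    simp only [ascRel, Function.comp_apply]
    rw [isPartialSum_reverse_blocks _ (by omega), show d - 2 - (d - 2 - i) = i by omega]
    refine and_congr (by omega) (forall_congr' fun _ => by omega)

/-! ### Standardization -/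

section Standardization

variable {C K : Type*} [LinearOrder K] {d : ℕ}

/-- The descents of the labelling `σ` with respect to `key`. -/
def IsDescent (key : C → K) (σ : C ≃ Fin d) (s : ℕ) : Prop :=
  ∃ h : s < d, key (σ.symm ⟨s, h⟩) < key (σ.symm ⟨s - 1, by omega⟩)

theorem existsUnique_strictMono_comp_symm (e : C ≃ Fin d) {f : C → K}
    (hf : Function.Injective f) : ∃! σ : C ≃ Fin d, StrictMono (f ∘ σ.symm) := by
  refine ⟨e.trans (Tuple.sort (f ∘ e.symm)).symm, ?_, fun σ hσ => ?_⟩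
  · exact (Tuple.monotone_sort (f ∘ e.symm)).strictMono_of_injective
      ((hf.comp e.symm.injective).comp (Equiv.injective _))
  · set τ := e.trans (Tuple.sort (f ∘ e.symm)).symm
    have hτ : StrictMono (f ∘ τ.symm) :=
      (Tuple.monotone_sort (f ∘ e.symm)).strictMono_of_injective
        ((hf.comp e.symm.injective).comp (Equiv.injective _))
    have hr : ∀ ρ : C ≃ Fin d, Set.range (f ∘ ρ.symm) = Set.range f := fun ρ =>
      EquivLike.range_comp f ρ.symm
    have h := (hσ.range_inj hτ).1 ((hr σ).trans (hr τ).symm)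
    have h' : σ.symm = τ.symm := Equiv.ext fun x => hf (congrFun h x)
    rw [← σ.symm_symm, h', τ.symm_symm]

/-- In the lexicographic order, consecutive cells may share an entry only if their keys increase; at
a descent of the labelling the entry must rise strictly. So these chains are the fillings whose
standardization is `σ`. -/
theorem chain_ascRel_isDescent_iff {key : C → K} (hkey : Function.Injective key)
    (σ : C ≃ Fin d) (T : C → ℕ) :
    Chain (ascRel (IsDescent key σ)) (T ∘ σ.symm) ↔
      StrictMono ((fun c => toLex (T c, key c)) ∘ σ.symm) := by
  have hstep : ∀ (i : ℕ) (hi : i + 1 < d),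
      ascRel (IsDescent key σ) i ((T ∘ σ.symm) ⟨i, by omega⟩) ((T ∘ σ.symm) ⟨i + 1, hi⟩) ↔
      toLex (T (σ.symm ⟨i, by omega⟩), key (σ.symm ⟨i, by omega⟩)) <
        toLex (T (σ.symm ⟨i + 1, hi⟩), key (σ.symm ⟨i + 1, hi⟩)) := by
    intro i hi
    have hne : key (σ.symm ⟨i, by omega⟩) ≠ key (σ.symm ⟨i + 1, hi⟩) := fun h => by
      have := Fin.mk.inj (σ.symm.injective (hkey h))
      omega
    have hD : IsDescent key σ (i + 1) ↔
        ¬ key (σ.symm ⟨i, by omega⟩) < key (σ.symm ⟨i + 1, hi⟩) := by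
      rw [not_lt]
      exact ⟨fun ⟨_, h⟩ => h.le, fun h => ⟨hi, lt_of_le_of_ne h hne.symm⟩⟩
    rw [Prod.Lex.toLex_lt_toLex, ascRel, hD]
    simp only [Function.comp_apply]
    by_cases hk : key (σ.symm ⟨i, by omega⟩) < key (σ.symm ⟨i + 1, hi⟩)
    · simp only [hk, not_true, false_implies, and_true]
      omega
    · simp only [hk, not_false_eq_true, true_implies, and_false, or_false]
      omega
  rw [Chain, forall₂_congr hstep]
  rcases d with _ | d
  · exact iff_of_true (fun i hi => absurd hi (by omega)) fun x => x.elim0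
  · rw [Fin.strictMono_iff_lt_succ]
    exact ⟨fun h i => h i (by omega), fun h i hi => h ⟨i, by omega⟩⟩

open Classical in
-- Sorting the cells by entry and then by `key` gives each filling exactly one labelling, so the sum
-- over fillings splits by standardization.
theorem gen_eq_sum_gen [Fintype C] [DecidableEq C] {key : C → K} (hkey : Function.Injective key)
    (e : C ≃ Fin d) (φ : (C → ℕ) → ℚ) :
    gen φ = ∑ σ : C ≃ Fin d, gen fun u : Fin d → ℕ =>
      (if Chain (ascRel (IsDescent key σ)) u then 1 else 0) * φ (u ∘ σ) := by
  have h : ∀ σ : C ≃ Fin d, gen (fun u : Fin d → ℕ =>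
      (if Chain (ascRel (IsDescent key σ)) u then 1 else 0) * φ (u ∘ σ)) =
      gen fun T : C → ℕ =>
        (if StrictMono ((fun c => toLex (T c, key c)) ∘ σ.symm) then 1 else 0) * φ T := by
    intro σ
    rw [← gen_reindex σ]
    congr 1
    funext T
    rw [Function.comp_assoc, σ.symm_comp_self, Function.comp_id]
    congr 1
    exact if_congr (chain_ascRel_isDescent_iff hkey σ T) rfl rfl
  simp_rw [h]
  rw [← map_sum]
  congr 1
  funext T
  have hinj : Function.Injective fun c => toLex (T c, key c) := fun a b hab =>
    hkey (congrArg (fun x => (ofLex x).2) hab)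
  obtain ⟨σ, hσ, huniq⟩ := existsUnique_strictMono_comp_symm e hinj
  rw [Finset.sum_apply, Finset.sum_eq_single_of_mem σ (mem_univ _), if_pos hσ, one_mul]
  exact fun τ _ hne => by rw [if_neg fun h => hne (huniq τ h), zero_mul]

open Classical in
/-- If a property `Q` of words is equivalent to a property `P` of their standardizations with
respect to `key`, then the words with property `Q` are enumerated by fundamental quasisymmetric
functions. -/
theorem gen_eq_sum_F [Fintype C] [DecidableEq C] {key : C → K} (hkey : Function.Injective key) (e : C ≃ Fin d)
    (Q : (C → ℕ) → Prop) (P : (C ≃ Fin d) → Prop)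
    (hPQ : ∀ (σ : C ≃ Fin d) (T : C → ℕ),
      (∀ a b, σ a < σ b ↔ T a < T b ∨ T a = T b ∧ key a < key b) → (Q T ↔ P σ)) :
    gen (fun T : C → ℕ => if Q T then 1 else 0) =
      ∑ σ : C ≃ Fin d with P σ, (F (ofPred d (IsDescent key σ)) : MvPowerSeries ℕ ℚ) := by
  rw [gen_eq_sum_gen hkey e, Finset.sum_filter]
  refine Finset.sum_congr rfl fun σ _ => ?_
  have hF : (F (ofPred d (IsDescent key σ)) : MvPowerSeries ℕ ℚ) =
      chainGen d (ascRel (IsDescent key σ)) := by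
    rw [F_eq_chainGen]
    refine chainGen_congr fun i a b hi => ?_
    rw [ascRel, ascRel, isPartialSum_ofPred _ hi]
  rw [hF, chainGen]
  have h : ∀ u : Fin d → ℕ, Chain (ascRel (IsDescent key σ)) u → (Q (u ∘ σ) ↔ P σ) := by
    intro u hu
    have hu' : Chain (ascRel (IsDescent key σ)) ((u ∘ σ) ∘ σ.symm) := by
      rwa [Function.comp_assoc, σ.self_comp_symm, Function.comp_id]
    rw [chain_ascRel_isDescent_iff hkey] at hu'
    refine hPQ σ _ fun a b => ?_
    rw [← hu'.lt_iff_lt]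
    simp only [Function.comp_apply, σ.symm_apply_apply]
    exact Prod.Lex.toLex_lt_toLex
  split_ifs with hP
  · congr 1
    funext u
    split_ifs with h1 h2 h2
    · simp
    · exact absurd ((h u h1).2 hP) h2
    · simp
    · simp
  · rw [← map_zero (gen (ι := Fin d))]
    congr 1
    funext u
    split_ifs with h1 h2 h2
    · exact absurd ((h u h1).1 h2) hP
    · simp
    · simp
    · simp

end Standardization

/-! ### Young composition tableaux -/

/-- The cells of the diagram of `α`. -/
abbrev Cell {d : ℕ} (α : Composition d) : Type := Σ i : Fin α.length, Fin (α.blocksFun i)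

theorem coeff_eq_sum_words {d : ℕ} {α : Composition d} (Q : Filling α → Prop) (m : ℕ →₀ ℕ)
    [DecidablePred fun u : Cell α → ℕ => Q (Sigma.curry u)] :
    (Set.ncard {T : Filling α | Q T ∧ content T = m} : ℚ) =
      MvPowerSeries.coeff m
        (gen fun u : Cell α → ℕ => if Q (Sigma.curry u) then (1 : ℚ) else 0) := by
  rw [coeff_gen, Finset.sum_boole, Nat.cast_inj, ← Set.ncard_coe_finset]
  have hinj : Function.Injective (fun u : Cell α → ℕ => (Sigma.curry u : Filling α)) :=
    fun u v h => funext fun c => congrFun (congrFun h c.1) c.2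
  rw [← Set.ncard_image_of_injective _ hinj]
  congr 1
  ext T
  have hw : wt (Sigma.uncurry T : Cell α → ℕ) = content T := Fintype.sum_sigma _
  simp only [coe_filter, mem_words, Set.mem_ofPred_eq, Set.mem_image]
  constructor
  · rintro ⟨hQ, hm⟩
    exact ⟨Sigma.uncurry T, ⟨hw.trans hm, hQ⟩, rfl⟩
  · rintro ⟨u, ⟨hm, hQ⟩, rfl⟩
    exact ⟨hQ, hw.symm.trans hm⟩

theorem entry_of_lt {d : ℕ} {α : Composition d} (T : Filling α) {i : Fin α.length} {k : ℕ}
    (h : k < α.blocksFun i) : entry T i k = (T i ⟨k, h⟩ : WithTop ℕ) := dif_pos h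

theorem entry_of_not_lt {d : ℕ} {α : Composition d} (T : Filling α) {i : Fin α.length} {k : ℕ}
    (h : ¬ k < α.blocksFun i) : entry T i k = ⊤ := dif_neg h

/-- The leftmost cell of row `i`. -/
def firstCell {d : ℕ} (α : Composition d) (i : Fin α.length) : Cell α :=
  ⟨i, ⟨0, α.one_le_blocksFun i⟩⟩

theorem entry_zero {d : ℕ} {α : Composition d} (u : Cell α → ℕ) (i : Fin α.length) :
    entry (Sigma.curry u : Filling α) i 0 = (u (firstCell α i) : WithTop ℕ) :=
  entry_of_lt _ (α.one_le_blocksFun i)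

/-- Resolves the convention `∞`: the hypothesis of the triple condition fails if `(j, k)` is
missing, and its conclusion fails if `(j, k + 1)` is missing, whence the existential. -/
theorem isSSYCT_curry_iff {d : ℕ} {α : Composition d} (u : Cell α → ℕ) :
    IsSSYCT (Sigma.curry u : Filling α) ↔
      (∀ (i : Fin α.length) (k k' : Fin (α.blocksFun i)), k < k' → u ⟨i, k⟩ ≤ u ⟨i, k'⟩) ∧
      (∀ i j : Fin α.length, i < j → u (firstCell α i) < u (firstCell α j)) ∧
      ∀ (i j : Fin α.length) (k : ℕ) (hi : k + 1 < α.blocksFun i) (hj : k < α.blocksFun j),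
        i < j → u ⟨j, ⟨k, hj⟩⟩ ≤ u ⟨i, ⟨k + 1, hi⟩⟩ →
          ∃ hj' : k + 1 < α.blocksFun j, u ⟨j, ⟨k + 1, hj'⟩⟩ < u ⟨i, ⟨k + 1, hi⟩⟩ := by
  constructor
  · rintro ⟨h1, h2, h3⟩
    refine ⟨fun i k k' h => h1 i h.le, fun i j h => ?_, fun i j k hi hj hij h => ?_⟩
    · have := h2 i j h
      rw [entry_zero, entry_zero] at this
      exact WithTop.coe_lt_coe.1 this
    · have := h3 i j k hij hi (by
        rw [entry_of_lt _ hj, entry_of_lt _ hi]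
        exact WithTop.coe_le_coe.2 h)
      by_cases hj' : k + 1 < α.blocksFun j
      · rw [entry_of_lt _ hj', entry_of_lt _ hi] at this
        exact ⟨hj', WithTop.coe_lt_coe.1 this⟩
      · rw [entry_of_not_lt _ hj'] at this
        exact absurd this not_top_lt
  · rintro ⟨h1, h2, h3⟩
    refine ⟨fun i => monotone_iff_forall_lt.2 fun k k' h => h1 i k k' h, fun i j h => ?_,
      fun i j k hij hi h => ?_⟩
    · rw [entry_zero, entry_zero]
      exact WithTop.coe_lt_coe.2 (h2 i j h)
    · by_cases hj : k < α.blocksFun j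
      · rw [entry_of_lt _ hj, entry_of_lt _ hi] at h
        obtain ⟨hj', h'⟩ := h3 i j k hi hj hij (WithTop.coe_le_coe.1 h)
        rw [entry_of_lt _ hj', entry_of_lt _ hi]
        exact WithTop.coe_lt_coe.2 h'
      · rw [entry_of_not_lt _ hj, entry_of_lt _ hi] at h
        exact absurd h (not_le.2 (WithTop.coe_lt_top _))

theorem isSSYRT_curry_iff {d : ℕ} {α : Composition d} (u : Cell α → ℕ) :
    IsSSYRT (Sigma.curry u : Filling α) ↔
      (∀ (i : Fin α.length) (k k' : Fin (α.blocksFun i)), k < k' → u ⟨i, k⟩ < u ⟨i, k'⟩) ∧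
      (∀ i j : Fin α.length, i < j → u (firstCell α i) ≤ u (firstCell α j)) ∧
      ∀ (i j : Fin α.length) (k : ℕ) (hi : k + 1 < α.blocksFun i) (hj : k < α.blocksFun j),
        i < j → u ⟨j, ⟨k, hj⟩⟩ < u ⟨i, ⟨k + 1, hi⟩⟩ →
          ∃ hj' : k + 1 < α.blocksFun j, u ⟨j, ⟨k + 1, hj'⟩⟩ ≤ u ⟨i, ⟨k + 1, hi⟩⟩ := by
  constructor
  · rintro ⟨h1, h2, h3⟩
    refine ⟨fun i k k' h => h1 i h, fun i j h => ?_, fun i j k hi hj hij h => ?_⟩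
    · have := h2 i j h
      rw [entry_zero, entry_zero] at this
      exact WithTop.coe_le_coe.1 this
    · have := h3 i j k hij hi (by
        rw [entry_of_lt _ hj, entry_of_lt _ hi]
        exact WithTop.coe_lt_coe.2 h)
      by_cases hj' : k + 1 < α.blocksFun j
      · rw [entry_of_lt _ hj', entry_of_lt _ hi] at this
        exact ⟨hj', WithTop.coe_le_coe.1 this⟩
      · rw [entry_of_not_lt _ hj', entry_of_lt _ hi] at this
        exact absurd this (not_le.2 (WithTop.coe_lt_top _))
  · rintro ⟨h1, h2, h3⟩
    refine ⟨fun i k k' h => h1 i k k' h, fun i j h => ?_, fun i j k hij hi h => ?_⟩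
    · rw [entry_zero, entry_zero]
      exact WithTop.coe_le_coe.2 (h2 i j h)
    · by_cases hj : k < α.blocksFun j
      · rw [entry_of_lt _ hj, entry_of_lt _ hi] at h
        obtain ⟨hj', h'⟩ := h3 i j k hi hj hij (WithTop.coe_lt_coe.1 h)
        rw [entry_of_lt _ hj', entry_of_lt _ hi]
        exact WithTop.coe_le_coe.2 h'
      · rw [entry_of_not_lt _ hj] at h
        exact absurd h not_top_lt

/-- The order in which equal entries of a Young composition tableau are standardized: by columns
from left to right, downwards in the leftmost column and upwards in the other columns. Equal entries
of a row-strict tableau are standardized in the opposite order. -/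
def cellKey {d : ℕ} {α : Composition d} (c : Cell α) : ℕ ×ₗ ℤ :=
  toLex ((c.2 : ℕ), if (c.2 : ℕ) = 0 then -(c.1 : ℤ) else c.1)

theorem cellKey_injective {d : ℕ} {α : Composition d} :
    Function.Injective (cellKey : Cell α → ℕ ×ₗ ℤ) := by
  rintro ⟨i, k⟩ ⟨j, l⟩ h
  have h1 : (k : ℕ) = l := congrArg (fun x => (ofLex x).1) h
  have h2 : (if (k : ℕ) = 0 then -(i : ℤ) else i) = if (l : ℕ) = 0 then -(j : ℤ) else j :=
    congrArg (fun x => (ofLex x).2) h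
  rw [h1] at h2
  obtain rfl : i = j := Fin.ext (by split_ifs at h2 <;> omega)
  obtain rfl : k = l := Fin.ext h1
  rfl

theorem cellKey_lt_of_col_lt {d : ℕ} {α : Composition d} {a b : Cell α}
    (h : (a.2 : ℕ) < b.2) : cellKey a < cellKey b :=
  Prod.Lex.toLex_lt_toLex.2 (Or.inl h)

theorem cellKey_firstCell {d : ℕ} {α : Composition d} {i j : Fin α.length} (h : i < j) :
    cellKey (firstCell α j) < cellKey (firstCell α i) := by
  refine Prod.Lex.toLex_lt_toLex.2 (Or.inr ⟨rfl, ?_⟩)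
  simpa [firstCell] using h

theorem cellKey_lt_of_row_lt {d : ℕ} {α : Composition d} {i j : Fin α.length} {k : ℕ} (h : i < j)
    (hi : k + 1 < α.blocksFun i) (hj : k + 1 < α.blocksFun j) :
    cellKey (⟨i, ⟨k + 1, hi⟩⟩ : Cell α) < cellKey (⟨j, ⟨k + 1, hj⟩⟩ : Cell α) := by
  refine Prod.Lex.toLex_lt_toLex.2 (Or.inr ⟨rfl, ?_⟩)
  simpa using h

/-- Standard Young composition tableaux. -/
structure IsStandard {d : ℕ} {α : Composition d} (σ : Cell α ≃ Fin d) : Prop where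
  row : ∀ (i : Fin α.length) (k k' : Fin (α.blocksFun i)), k < k' → σ ⟨i, k⟩ < σ ⟨i, k'⟩
  col : ∀ i j : Fin α.length, i < j → σ (firstCell α i) < σ (firstCell α j)
  triple : ∀ (i j : Fin α.length) (k : ℕ) (hi : k + 1 < α.blocksFun i) (hj : k < α.blocksFun j),
    i < j → σ ⟨j, ⟨k, hj⟩⟩ < σ ⟨i, ⟨k + 1, hi⟩⟩ →
      ∃ hj' : k + 1 < α.blocksFun j, σ ⟨j, ⟨k + 1, hj'⟩⟩ < σ ⟨i, ⟨k + 1, hi⟩⟩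

/-- For every comparison in the definition, `cellKey` breaks ties the right way: it increases along
rows and from `(j, k)` to `(i, k + 1)`, where equality counts as small, and decreases up the first
column and from `(j, k + 1)` to `(i, k + 1)`, where strictness is required. -/
theorem isSSYCT_iff_isStandard {d : ℕ} {α : Composition d} (σ : Cell α ≃ Fin d) (T : Cell α → ℕ)
    (h : ∀ a b, σ a < σ b ↔ T a < T b ∨ T a = T b ∧ cellKey a < cellKey b) :
    IsSSYCT (Sigma.curry T : Filling α) ↔ IsStandard σ := by
  have hle : ∀ {a b}, σ a < σ b → T a ≤ T b := fun {a b} hab => by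
    rcases (h a b).1 hab with h1 | h1
    · exact h1.le
    · exact h1.1.le
  have hkey : ∀ {a b}, T a ≤ T b → cellKey a < cellKey b → σ a < σ b := fun {a b} hab hk =>
    (h a b).2 (hab.lt_or_eq.imp_right fun h1 => ⟨h1, hk⟩)
  have hlt : ∀ {a b}, σ a < σ b → cellKey b < cellKey a → T a < T b := fun {a b} hab hk =>
    ((h a b).1 hab).resolve_right fun h1 => lt_asymm hk h1.2
  rw [isSSYCT_curry_iff]
  constructor
  · rintro ⟨h1, h2, h3⟩
    refine ⟨fun i k k' hk => hkey (h1 i k k' hk) (cellKey_lt_of_col_lt hk),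
      fun i j hij => (h _ _).2 (Or.inl (h2 i j hij)), fun i j k hi hj hij hlt => ?_⟩
    obtain ⟨hj', h4⟩ := h3 i j k hi hj hij (hle hlt)
    exact ⟨hj', (h _ _).2 (Or.inl h4)⟩
  · rintro ⟨h1, h2, h3⟩
    refine ⟨fun i k k' hk => hle (h1 i k k' hk),
      fun i j hij => hlt (h2 i j hij) (cellKey_firstCell hij), fun i j k hi hj hij hT => ?_⟩
    obtain ⟨hj', h4⟩ := h3 i j k hi hj hij (hkey hT (cellKey_lt_of_col_lt (Nat.lt_succ_self k)))
    exact ⟨hj', hlt h4 (cellKey_lt_of_row_lt hij hi hj')⟩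

/-- The row-strict definition exchanges `<` and `≤` in every comparison, which is exactly the effect
of reversing the tie-breaking order; hence the same standard tableaux. -/
theorem isSSYRT_iff_isStandard {d : ℕ} {α : Composition d} (σ : Cell α ≃ Fin d) (T : Cell α → ℕ)
    (h : ∀ a b, σ a < σ b ↔ T a < T b ∨ T a = T b ∧ cellKey b < cellKey a) :
    IsSSYRT (Sigma.curry T : Filling α) ↔ IsStandard σ := by
  have hle : ∀ {a b}, σ a < σ b → T a ≤ T b := fun {a b} hab => by
    rcases (h a b).1 hab with h1 | h1
    · exact h1.le
    · exact h1.1.le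
  have hkey : ∀ {a b}, T a ≤ T b → cellKey b < cellKey a → σ a < σ b := fun {a b} hab hk =>
    (h a b).2 (hab.lt_or_eq.imp_right fun h1 => ⟨h1, hk⟩)
  have hlt : ∀ {a b}, σ a < σ b → cellKey a < cellKey b → T a < T b := fun {a b} hab hk =>
    ((h a b).1 hab).resolve_right fun h1 => lt_asymm hk h1.2
  rw [isSSYRT_curry_iff]
  constructor
  · rintro ⟨h1, h2, h3⟩
    refine ⟨fun i k k' hk => (h _ _).2 (Or.inl (h1 i k k' hk)),
      fun i j hij => hkey (h2 i j hij) (cellKey_firstCell hij), fun i j k hi hj hij hσ => ?_⟩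
    obtain ⟨hj', h4⟩ :=
      h3 i j k hi hj hij (hlt hσ (cellKey_lt_of_col_lt (Nat.lt_succ_self k)))
    exact ⟨hj', hkey h4 (cellKey_lt_of_row_lt hij hi hj')⟩
  · rintro ⟨h1, h2, h3⟩
    refine ⟨fun i k k' hk => hlt (h1 i k k' hk) (cellKey_lt_of_col_lt hk),
      fun i j hij => hle (h2 i j hij), fun i j k hi hj hij hT => ?_⟩
    obtain ⟨hj', h4⟩ := h3 i j k hi hj hij ((h _ _).2 (Or.inl hT))
    exact ⟨hj', hle h4⟩

/-! ### Fundamental expansions and the action of omega -/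

open Classical in
theorem youngS_eq_sum_F {d : ℕ} (α : Composition d) :
    youngS α = ∑ σ : Cell α ≃ Fin d with IsStandard σ,
      (F (ofPred d (IsDescent cellKey σ)) : MvPowerSeries ℕ ℚ) := by
  rw [← gen_eq_sum_F cellKey_injective α.blocksFinEquiv
    (fun T : Cell α → ℕ => IsSSYCT (Sigma.curry T : Filling α)) _ isSSYCT_iff_isStandard]
  ext m
  exact coeff_eq_sum_words IsSSYCT m

open Classical in
theorem youngR_eq_sum_F {d : ℕ} (α : Composition d) :
    youngR α = ∑ σ : Cell α ≃ Fin d with IsStandard σ,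
      (F (complement (ofPred d (IsDescent cellKey σ))) : MvPowerSeries ℕ ℚ) := by
  have h := gen_eq_sum_F (key := fun c : Cell α => OrderDual.toDual (cellKey c))
    (OrderDual.toDual.injective.comp cellKey_injective) α.blocksFinEquiv
    (fun T : Cell α → ℕ => IsSSYRT (Sigma.curry T : Filling α)) _ isSSYRT_iff_isStandard
  -- Keys of consecutive cells are distinct, so under the dual order descents and non-descents
  -- change places.
  have hc : ∀ σ : Cell α ≃ Fin d,
      ofPred d (IsDescent (fun c : Cell α => OrderDual.toDual (cellKey c)) σ) =
        complement (ofPred d (IsDescent cellKey σ)) := by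
    intro σ
    refine composition_ext_of_isPartialSum fun i hi => ?_
    rw [isPartialSum_ofPred _ hi, isPartialSum_complement _ hi, isPartialSum_ofPred _ hi]
    have hne : cellKey (σ.symm ⟨i, by omega⟩) ≠ cellKey (σ.symm ⟨i + 1, hi⟩) := fun h => by
      have := Fin.mk.inj (σ.symm.injective (cellKey_injective h))
      omega
    constructor
    · rintro ⟨_, h1⟩ ⟨_, h2⟩
      exact lt_asymm (OrderDual.toDual_lt_toDual.1 h1) h2
    · intro h1
      refine ⟨hi, OrderDual.toDual_lt_toDual.2 (lt_of_le_of_ne (not_lt.1 fun h2 => ?_) hne)⟩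
      exact h1 ⟨hi, h2⟩
  simp_rw [hc] at h
  rw [← h]
  ext m
  exact coeff_eq_sum_words IsSSYRT m

theorem youngS_mem_QSym {d : ℕ} (α : Composition d) : youngS α ∈ QSym := by
  classical
  rw [youngS_eq_sum_F]
  exact Submodule.sum_mem _ fun σ _ => (F _).2

theorem IsOmega.inVars_youngS {ω : QSym →ₗ[ℚ] QSym} (hω : IsOmega ω) {d : ℕ} (α : Composition d)
    (n : ℕ) : inVars n (ω ⟨youngS α, youngS_mem_QSym α⟩) = inVarsRev n (youngR α) := by
  classical
  have h : (⟨youngS α, youngS_mem_QSym α⟩ : QSym) =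
      ∑ σ : Cell α ≃ Fin d with IsStandard σ, F (ofPred d (IsDescent cellKey σ)) :=
    Subtype.ext <| (youngS_eq_sum_F α).trans (AddSubmonoidClass.coe_finsetSum _ _).symm
  rw [h, map_sum, youngR_eq_sum_F, AddSubmonoidClass.coe_finsetSum]
  -- Unfolding `w` exposes the reversal of the complement, so the two sides match term by term over
  -- the same standard tableaux.
  simp_rw [isOmega_iff.1 hω, w]
  have hS : ∀ (s : Finset (Cell α ≃ Fin d)) (f : (Cell α ≃ Fin d) → MvPowerSeries ℕ ℚ),
      inVars n (∑ σ ∈ s, f σ) = ∑ σ ∈ s, inVars n (f σ) := fun s f => map_sum _ _ _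
  have hR : ∀ (s : Finset (Cell α ≃ Fin d)) (f : (Cell α ≃ Fin d) → MvPowerSeries ℕ ℚ),
      inVarsRev n (∑ σ ∈ s, f σ) = ∑ σ ∈ s, inVarsRev n (f σ) := fun s f => by
    simp_rw [inVarsRev, hS, map_sum]
  rw [hS, hR]
  exact Finset.sum_congr rfl fun σ _ => inVars_F_reverse n _

end

end YoungQSym

theorem mainTheorem7 :
    (∃! ω : YoungQSym.QSym →ₗ[ℚ] YoungQSym.QSym, YoungQSym.IsOmega ω) ∧
    ∀ ω : YoungQSym.QSym →ₗ[ℚ] YoungQSym.QSym, YoungQSym.IsOmega ω →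
      (∀ (d : ℕ) (α : Composition d), ω (YoungQSym.F α) = YoungQSym.F (YoungQSym.w α)) ∧
      Function.Involutive ω ∧
      ∀ (d : ℕ) (α : Composition d),
        ∃ h : YoungQSym.youngS α ∈ YoungQSym.QSym,
          ∀ n : ℕ,
            YoungQSym.inVars n (ω ⟨YoungQSym.youngS α, h⟩) =
              YoungQSym.inVarsRev n (YoungQSym.youngR α) :=
  ⟨YoungQSym.existsUnique_isOmega, fun _ hω => ⟨YoungQSym.isOmega_iff.1 hω, hω.involutive,
    fun _ α => ⟨YoungQSym.youngS_mem_QSym α, hω.inVars_youngS α⟩⟩⟩
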